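/- Setting. Let $\mathcal S$ be a finite state space, $\gamma\in(0,1)$, and let a fixed policy induce the transition matrix $P$ (row-stochastic, irreducible and aperiodic, with stationary distribution $\pi$, $D=\mathrm{diag}(\pi)$) and the reward function $R:\mathcal S\to\mathbb R$ with $|R(s)|\le\bar r$ for all $s$, where $\bar r>0$. Let $\phi(s)\in\mathbb R^K$ be feature vectors with $\|\phi(s)\|_2^2\le 1$, the rows of a matrix $\Phi$ with linearly independent columns, and let $\omega$ be the smallest eigenvalue of $\Phi^\top D\Phi$. Let $\theta^*$ be the solution of the projected Bellman equation $\Pi_D\mathcal T(\Phi\theta^*)=\Phi\theta^*$, where $(\mathcal TV)(s)=R(s)+\gamma\sum_{s'}P(s,s')V(s')$ and $\Pi_D$ is the projection onto the column space of $\Phi$, orthogonal for $\langle U,V\rangle_D=\sum_s\pi(s)U(s)V(s)$. Let $(s_t)_{t\ge0}$ be a Markov chain with transition matrix $P$ and arbitrary initial distribution, $X_t=(s_t,s_{t+1},R(s_t))$, and $$g(X_t,\theta)=\big(R(s_t)+\gamma\langle\phi(s_{t+1}),\theta\rangle-\langle\phi(s_t),\theta\rangle\big)\phi(s_t),\qquad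 \bar g(\theta)=\mathbb E_{s_t\sim\pi}[g(X_t,\theta)].$$ Algorithm. Let $\mathcal B\subset\mathbb R^K$ be convex and compact with $\theta^*\in\mathcal B$ and $\|\theta\|_2\le G$ for all $\theta\in\mathcal B$, where $G\ge1$; let $\Pi_{\mathcal B}$ be the Euclidean projection onto $\mathcal B$. Let $\delta\ge1$ and let $\mathcal Q_\delta:\mathbb R^K\to\mathbb R^K$ be any map with $\|\mathcal Q_\delta(x)-x\|_2^2\le(1-1/\delta)\|x\|_2^2$ for all $x$. With $\theta_0\in\mathcal B$ and $e_{-1}=0$, projected EF-TD with step-size $\alpha>0$ is, for $t\ge0$, $$h_t=\mathcal Q_\delta(e_{t-1}+g(X_t,\theta_t)),\qquad \theta_{t+1}=\Pi_{\mathcal B}(\theta_t+\alpha h_t),\qquad e_t=e_{t-1}+g(X_t,\theta_t)-h_t.$$ Let $\tau$ be the least $t\ge1$ such that $\|\mathbb E[g(X_k,\theta)\mid s_0=s]-\bar g(\theta)\|_2\le\alpha(\|\theta\|_2+1)$ for all $k\ge t$, all $\theta\in\mathbb R^K$ and all $s\in\mathcal S$. Theorem 3 (Markov setting). There is a universal constant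 $c\ge1$, and there are constants $\kappa_1,\kappa_2>0$ depending only on the reward bound $\bar r$ (hence absolute when rewards are normalized by $\bar r=1$), such that in the above setting, whenever $0<\alpha\le(1-\gamma)/c$, the mixing time $\tau$ is well defined (finite) and for every $T\ge\tau$ $$\mathbb E\big[\|\theta_T-\theta^*\|_2^2\big]\le \kappa_1\big(\alpha^2\delta^2G^2+G^2\big)\big(1-\alpha\omega(1-\gamma)\big)^{T-\tau}+\kappa_2\,\frac{\alpha\tau\delta^2G^2}{\omega(1-\gamma)}.$$ -/

import Mathlib

open MeasureTheory

noncomputable section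

/-- Policy evaluation with linear function approximation: the Markov reward process induced by the
policy (transition matrix `P`, expected instantaneous reward `R`), the discount factor `γ`, and
the feature vectors `φ s`, i.e. the rows of the feature matrix `Φ`. Data only. -/
structure PolicyEval (S : Type*) (K : ℕ) where
  P : Matrix S S ℝ
  R : S → ℝ
  γ : ℝ
  φ : S → EuclideanSpace ℝ (Fin K)

/-- Every state has period one: the only common divisor of the possible return times is `1`. -/
def IsAperiodicMatrix {S : Type*} [Fintype S] [DecidableEq S] (P : Matrix S S ℝ) : Prop :=
  ∀ s : S, ∀ d : ℕ, (∀ k : ℕ, 1 ≤ k → 0 < (P ^ k) s s → d ∣ k) → d = 1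

/-- Minimizer of the Euclidean distance to `x` over `B`. -/
def IsNearestPoint {E : Type*} [NormedAddCommGroup E] (B : Set E) (x y : E) : Prop :=
  y ∈ B ∧ ∀ z ∈ B, ‖x - y‖ ≤ ‖x - z‖

/-- The projection `x ↦ argmin_{y ∈ B} ‖x - y‖`
(used for nonempty compact convex sets in Euclidean space, where the minimizer exists and
is unique). -/
def setProj {E : Type*} [NormedAddCommGroup E] (B : Set E) (x : E) : E :=
  Classical.epsilon (IsNearestPoint B x)

theorem isNearestPoint_setProj {E : Type*} [NormedAddCommGroup E] {B : Set E}
    (hB : IsCompact B) (hne : B.Nonempty) (x : E) : IsNearestPoint B x (setProj B x) := by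
  have hc : ContinuousOn (fun y => ‖x - y‖) B := by fun_prop
  obtain ⟨y, hy, hmin⟩ := hB.exists_isMinOn hne hc
  exact Classical.epsilon_spec (p := IsNearestPoint B x) ⟨y, hy, fun z hz => hmin hz⟩

/-- `s` is a time-homogeneous Markov chain on `S` with transition matrix `P` under `μ`, with
arbitrary initial distribution. -/
structure IsMarkovChain {S : Type*} [MeasurableSpace S] {Ω : Type*} [MeasurableSpace Ω]
    (μ : Measure Ω) (P : Matrix S S ℝ) (s : ℕ → Ω → S) : Prop where
  measurable : ∀ t, Measurable (s t)
  step : ∀ (t : ℕ) (x : ℕ → S),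
    μ.real {ω | ∀ i ≤ t + 1, s i ω = x i}
      = μ.real {ω | ∀ i ≤ t, s i ω = x i} * P (x t) (x (t + 1))

/-- The contraction property of the compression operator `Q_δ`. -/
def IsCompressor {E : Type*} [NormedAddCommGroup E] (δ : ℝ) (Q : E → E) : Prop :=
  ∀ x : E, ‖Q x - x‖ ^ 2 ≤ (1 - 1 / δ) * ‖x‖ ^ 2

namespace PolicyEval

variable {S : Type*} [Fintype S] [DecidableEq S] {K : ℕ}

/-- The standing assumptions on the chain, the rewards and the features. -/
structure Standing (M : PolicyEval S K) (rbar : ℝ) : Prop where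
  stochastic : M.P ∈ Matrix.rowStochastic ℝ S
  irreducible : M.P.IsIrreducible
  aperiodic : IsAperiodicMatrix M.P
  γ_pos : 0 < M.γ
  γ_lt_one : M.γ < 1
  reward_bound : ∀ s, |M.R s| ≤ rbar
  features_indep : LinearIndependent ℝ (fun (k : Fin K) (s : S) => M.φ s k)
  features_norm : ∀ s, ‖M.φ s‖ ^ 2 ≤ 1

/-- `π` is a stationary distribution of the chain. -/
def IsStationary (M : PolicyEval S K) (π : S → ℝ) : Prop :=
  π ∈ stdSimplex ℝ S ∧ Matrix.vecMul π M.P = π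

/-- The feature matrix `Φ`, with rows `φ s`. -/
def Phi (M : PolicyEval S K) : Matrix S (Fin K) ℝ := Matrix.of fun s k => M.φ s k

/-- `Σ = Φᵀ D Φ`, where `D = diag π`. -/
def Sigma (M : PolicyEval S K) (π : S → ℝ) : Matrix (Fin K) (Fin K) ℝ :=
  M.Phi.transpose * Matrix.diagonal π * M.Phi

/-- `ω` is the smallest eigenvalue of `Σ`. -/
def IsSmallestEigenvalue (M : PolicyEval S K) (π : S → ℝ) (ω : ℝ) : Prop :=
  IsLeast {l : ℝ | Module.End.HasEigenvalue (Matrix.toLin' (M.Sigma π)) l} ω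

/-- The approximate value function `V̂_θ = Φ θ`. -/
def valueApprox (M : PolicyEval S K) (θ : EuclideanSpace ℝ (Fin K)) : S → ℝ :=
  fun s => inner ℝ (M.φ s) θ

/-- The Bellman operator of the policy. -/
def bellman (M : PolicyEval S K) (V : S → ℝ) : S → ℝ :=
  fun s => M.R s + M.γ * ∑ s', M.P s s' * V s'

/-- `W` is the projection of `V` onto the span of the columns of `Φ`, orthogonal with
respect to `⟨U, V⟩_D = ∑ s, π s * U s * V s`. -/
def IsProjD (M : PolicyEval S K) (π : S → ℝ) (V W : S → ℝ) : Prop :=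
  W ∈ Submodule.span ℝ (Set.range fun (k : Fin K) (s : S) => M.φ s k) ∧
    ∀ U ∈ Submodule.span ℝ (Set.range fun (k : Fin K) (s : S) => M.φ s k),
      ∑ s, π s * (V s - W s) * U s = 0

/-- The projected Bellman equation `Π_D T (Φ θ) = Φ θ`. -/
def SolvesProjectedBellman (M : PolicyEval S K) (π : S → ℝ) (θ : EuclideanSpace ℝ (Fin K)) :
    Prop :=
  M.IsProjD π (M.bellman (M.valueApprox θ)) (M.valueApprox θ)

/-- The TD(0) direction `g(X, θ)` for the data tuple `X = (s, s', R s)`. -/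
def tdDir (M : PolicyEval S K) (s s' : S) (θ : EuclideanSpace ℝ (Fin K)) :
    EuclideanSpace ℝ (Fin K) :=
  (M.R s + M.γ * inner ℝ (M.φ s') θ - inner ℝ (M.φ s) θ) • M.φ s

/-- The steady-state direction `ḡ(θ)`: the mean of `g(X, θ)` when `s ∼ π` and `s' ∼ P(s, ·)`. -/
def meanDir (M : PolicyEval S K) (π : S → ℝ) (θ : EuclideanSpace ℝ (Fin K)) :
    EuclideanSpace ℝ (Fin K) :=
  ∑ s, π s • ∑ s', M.P s s' • M.tdDir s s' θ

/-- `E[g(X_k, θ) | s_0 = s₀]`, where `X_k = (s_k, s_{k+1}, R s_k)`. -/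
def condDir (M : PolicyEval S K) (k : ℕ) (s₀ : S) (θ : EuclideanSpace ℝ (Fin K)) :
    EuclideanSpace ℝ (Fin K) :=
  ∑ s, (M.P ^ k) s₀ s • ∑ s', M.P s s' • M.tdDir s s' θ

/-- `τ` is the mixing time at precision `ε`. -/
def IsMixingTime (M : PolicyEval S K) (π : S → ℝ) (ε : ℝ) (τ : ℕ) : Prop :=
  IsLeast {t : ℕ | 1 ≤ t ∧ ∀ k, t ≤ k → ∀ (θ : EuclideanSpace ℝ (Fin K)) (s₀ : S),
    ‖M.condDir k s₀ θ - M.meanDir π θ‖ ≤ ε * (‖θ‖ + 1)} τ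

/-- Projected EF-TD driven by the state trajectory `x`:
at time `t` the state of the algorithm is the pair `(θ_t, e_{t-1})`, started at `(θ₀, 0)`. -/
def efTD (M : PolicyEval S K) (Q : EuclideanSpace ℝ (Fin K) → EuclideanSpace ℝ (Fin K))
    (B : Set (EuclideanSpace ℝ (Fin K))) (α : ℝ) (θ₀ : EuclideanSpace ℝ (Fin K)) (x : ℕ → S) :
    ℕ → EuclideanSpace ℝ (Fin K) × EuclideanSpace ℝ (Fin K)
  | 0 => (θ₀, 0)
  | t + 1 =>
    let θ := (efTD M Q B α θ₀ x t).1
    let e := (efTD M Q B α θ₀ x t).2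
    let g := M.tdDir (x t) (x (t + 1)) θ
    let h := Q (e + g)
    (setProj B (θ + α • h), e + g - h)

end PolicyEval

end

/-! The Lyapunov function is the squared distance to `θstar` of the perturbed iterate `θ_t + α
e_{t-1}`. Without the projection this point makes an exact TD step, since `h_t` cancels; the
projection costs only `α² ‖e_t‖²` (`IsNearestPoint.norm_sq_errorFeedback_le`). The compressor
shrinks residuals by `1 - 1/(2δ)`, so the memory stays of order `δ G` and all these corrections are
`O(α² δ² G²)`.

The mean direction drifts towards `θstar` at rate `(1 - γ) ωmin` (`inner_sub_meanDir_le`): `P` does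
not expand the `π`-weighted norm, and `ωmin` compares that norm with the Euclidean one.

Markov noise is handled by looking back `τ` steps. Replacing the current parameter by the one `τ`
steps older costs `O(α τ δ G²)`; given the path up to the older time, the noise at the old parameter
has conditional mean `O(α G²)` by the choice of `τ` (`integral_noise_le`). The outcome is a scalar
recursion with factor `1 - α ωmin (1 - γ)` and error `O(α² τ δ² G²)`, started at time `τ` from a
crude bound.

Finiteness of `τ` is the convergence theorem for finite chains: some power of `P` is strictly
positive, hence contracts zero-mass vectors in `ℓ¹`. -/

/-! ### Convergence of finite irreducible aperiodic chains -/

section MarkovMatrix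

open Matrix Filter Topology

variable {S : Type*} [Fintype S] [DecidableEq S]

theorem pow_mul_pow_le_pow_add {P : Matrix S S ℝ} (hP : ∀ i j, 0 ≤ P i j) (m n : ℕ) (i j k : S) :
    (P ^ m) i j * (P ^ n) j k ≤ (P ^ (m + n)) i k := by
  rw [pow_add, mul_apply]
  exact Finset.single_le_sum (f := fun l => (P ^ m) i l * (P ^ n) l k)
    (fun l _ => mul_nonneg (pow_apply_nonneg hP m i l) (pow_apply_nonneg hP n l k))
    (Finset.mem_univ j)

/-- Return times are closed under addition and have gcd one, so they contain all large integers. -/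
theorem exists_return_pos {P : Matrix S S ℝ} (hP : ∀ i j, 0 ≤ P i j)
    (hap : IsAperiodicMatrix P) (i : S) : ∃ N, ∀ n ≥ N, 0 < (P ^ n) i i := by
  set R : Set ℕ := {k | 1 ≤ k ∧ 0 < (P ^ k) i i} with hR
  have hgcd : Nat.setGcd R = 1 :=
    hap i _ fun k hk hpos => Nat.setGcd_dvd_of_mem ⟨hk, hpos⟩
  obtain ⟨N, hN⟩ := Nat.exists_mem_closure_of_ge R
  refine ⟨N, fun n hn => ?_⟩
  have hmem := hN n hn (by simp [hgcd])
  clear hn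
  induction hmem using AddSubmonoid.closure_induction with
  | mem k hk => exact hk.2
  | zero => simp
  | add a b _ _ ha hb =>
    exact (mul_pos ha hb).trans_le (pow_mul_pow_le_pow_add hP a b i i i)

theorem exists_pow_pos {P : Matrix S S ℝ} (hirr : P.IsIrreducible)
    (hap : IsAperiodicMatrix P) : ∃ N, ∀ i j, 0 < (P ^ N) i j := by
  have hP := hirr.nonneg
  choose N hN using exists_return_pos hP hap
  choose k _ hk using (isIrreducible_iff_exists_pow_pos hP).1 hirr
  -- Any common bound of the `N i + k i j` works: loop at `i` for the surplus time, then walk to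
  -- `j`.
  refine ⟨∑ i, (N i + ∑ j, k i j), fun i j => ?_⟩
  have h1 : N i + ∑ j, k i j ≤ ∑ i, (N i + ∑ j, k i j) :=
    Finset.single_le_sum (f := fun i => N i + ∑ j, k i j) (by simp) (Finset.mem_univ i)
  have h2 : k i j ≤ ∑ j, k i j :=
    Finset.single_le_sum (f := fun j => k i j) (by simp) (Finset.mem_univ j)
  obtain ⟨n, hn⟩ := Nat.exists_eq_add_of_le (show k i j ≤ ∑ i, (N i + ∑ j, k i j) by omega)
  rw [hn, add_comm]
  exact (mul_pos (hN i n (by omega)) (hk i j)).trans_le (pow_mul_pow_le_pow_add hP _ _ i i j)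

/-- Doeblin's argument: as `x` has mass zero, subtracting `ε` from every entry of `Q` does not
change the product, and the remaining nonnegative rows sum to `1 - ε * card S`. -/
theorem sum_abs_vecMul_le {Q : Matrix S S ℝ} (hQ : Q ∈ rowStochastic ℝ S) {ε : ℝ}
    (hε : ∀ i j, ε ≤ Q i j) {x : S → ℝ} (hx : ∑ i, x i = 0) :
    ∑ j, |vecMul x Q j| ≤ (1 - ε * Fintype.card S) * ∑ i, |x i| := by
  have hj : ∀ j, |vecMul x Q j| ≤ ∑ i, |x i| * (Q i j - ε) := by
    intro j
    have : vecMul x Q j = ∑ i, x i * (Q i j - ε) := by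
      simp [vecMul, dotProduct, mul_sub, Finset.sum_sub_distrib, ← Finset.sum_mul, hx]
    rw [this]
    refine (Finset.abs_sum_le_sum_abs _ _).trans (Finset.sum_le_sum fun i _ => ?_)
    rw [abs_mul, abs_of_nonneg (sub_nonneg.2 (hε i j))]
  refine (Finset.sum_le_sum fun j _ => hj j).trans (le_of_eq ?_)
  rw [Finset.sum_comm, Finset.mul_sum]
  refine Finset.sum_congr rfl fun i _ => ?_
  rw [← Finset.mul_sum, Finset.sum_sub_distrib, sum_row_of_mem_rowStochastic hQ]
  simp
  ring

theorem vecMul_pow_of_vecMul_eq {P : Matrix S S ℝ} {π : S → ℝ} (h : vecMul π P = π) (n : ℕ) :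
    vecMul π (P ^ n) = π := by
  induction n with
  | zero => simp
  | succ n ih => rw [pow_succ, ← vecMul_vecMul, ih, h]

theorem tendsto_sum_abs_pow_sub {P : Matrix S S ℝ} (hP : P ∈ rowStochastic ℝ S)
    (hirr : P.IsIrreducible) (hap : IsAperiodicMatrix P) {π : S → ℝ} (hπ : π ∈ stdSimplex ℝ S)
    (hst : vecMul π P = π) (i : S) :
    Tendsto (fun k => ∑ j, |(P ^ k) i j - π j|) atTop (𝓝 0) := by
  obtain ⟨N, hN⟩ := exists_pow_pos hirr hap
  have hne : Nonempty S := ⟨i⟩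
  obtain ⟨p, hp⟩ := Finite.exists_min (fun p : S × S => (P ^ N) p.1 p.2)
  set ε := (P ^ N) p.1 p.2 with hε
  have hεpos : 0 < ε := hN _ _
  set ρ := 1 - ε * Fintype.card S with hρ
  have hcard : (0 : ℝ) < Fintype.card S := by exact_mod_cast Fintype.card_pos
  have hρ1 : ρ < 1 := by have := mul_pos hεpos hcard; linarith
  have hρ0 : 0 ≤ ρ := by
    have h1 := sum_row_of_mem_rowStochastic (pow_mem hP N) i
    have h2 : ∑ _j : S, ε ≤ ∑ j, (P ^ N) i j := Finset.sum_le_sum fun j _ => hp (i, j)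
    rw [h1] at h2
    simp only [Finset.sum_const, Finset.card_univ, nsmul_eq_mul] at h2
    linarith
  set a : ℕ → ℝ := fun k => ∑ j, |(P ^ k) i j - π j| with ha
  have hstep : ∀ k m, ∀ j, (P ^ (k + m)) i j - π j
      = vecMul (fun j => (P ^ k) i j - π j) (P ^ m) j := by
    intro k m j
    have h2 := congrFun (vecMul_pow_of_vecMul_eq hst m) j
    rw [pow_add, mul_apply]
    simp only [vecMul, dotProduct] at h2 ⊢
    simp only [sub_mul, Finset.sum_sub_distrib, h2]
  have hzero : ∀ k, ∑ j, ((P ^ k) i j - π j) = 0 := by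
    intro k
    rw [Finset.sum_sub_distrib, sum_row_of_mem_rowStochastic (pow_mem hP k), hπ.2, sub_self]
  -- The case `ε = 0` gives monotonicity, which carries geometric decay along multiples of `N` to
  -- all times.
  have hanti : ∀ k m, a (k + m) ≤ a k := by
    intro k m
    have := sum_abs_vecMul_le (pow_mem hP m) (ε := 0)
      (fun i j => nonneg_of_mem_rowStochastic (pow_mem hP m)) (hzero k)
    simpa [ha, hstep k m] using this
  have hcontr : ∀ k, a (k + N) ≤ ρ * a k := by
    intro k
    have := sum_abs_vecMul_le (pow_mem hP N) (fun i j => hp (i, j)) (hzero k)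
    simpa [ha, hstep k N] using this
  have hgeo : ∀ m, a (m * N) ≤ ρ ^ m * a 0 := by
    intro m
    induction m with
    | zero => simp
    | succ m ih =>
      calc a ((m + 1) * N) = a (m * N + N) := by ring_nf
        _ ≤ ρ * a (m * N) := hcontr _
        _ ≤ ρ * (ρ ^ m * a 0) := by gcongr
        _ = ρ ^ (m + 1) * a 0 := by ring
  have hlim : Tendsto (fun m : ℕ => ρ ^ m * a 0) atTop (𝓝 0) := by
    simpa using (tendsto_pow_atTop_nhds_zero_of_lt_one hρ0 hρ1).mul_const (a 0)
  rw [Metric.tendsto_atTop]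
  intro η hη
  obtain ⟨m, hm⟩ := (hlim.eventually (gt_mem_nhds hη)).exists
  refine ⟨m * N, fun n hn => ?_⟩
  obtain ⟨r, rfl⟩ := Nat.exists_eq_add_of_le hn
  have h0 : 0 ≤ a (m * N + r) := Finset.sum_nonneg fun j _ => abs_nonneg _
  rw [Real.dist_eq, sub_zero, abs_of_nonneg h0]
  exact ((hanti _ _).trans (hgeo m)).trans_lt hm

theorem stationary_pos {P : Matrix S S ℝ} (hirr : P.IsIrreducible) (hap : IsAperiodicMatrix P)
    {π : S → ℝ} (hπ : π ∈ stdSimplex ℝ S) (hst : vecMul π P = π) (j : S) : 0 < π j := by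
  obtain ⟨N, hN⟩ := exists_pow_pos hirr hap
  rw [← congrFun (vecMul_pow_of_vecMul_eq hst N) j]
  obtain ⟨i, hi⟩ : ∃ i, 0 < π i := by
    by_contra! h
    have : ∑ i, π i ≤ 0 := Finset.sum_nonpos fun i _ => h i
    linarith [hπ.2]
  exact Finset.sum_pos' (fun i _ => mul_nonneg (hπ.1 i) (hN i j).le)
    ⟨i, Finset.mem_univ i, mul_pos hi (hN i j)⟩

end MarkovMatrix

theorem norm_sum_smul_le {ι E : Type*} [Fintype ι] [NormedAddCommGroup E] [NormedSpace ℝ E] (p : ι → ℝ)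
    {v : ι → E} {C : ℝ} (hv : ∀ s, ‖v s‖ ≤ C) : ‖∑ s, p s • v s‖ ≤ (∑ s, |p s|) * C := by
  rw [Finset.sum_mul]
  refine (norm_sum_le _ _).trans (Finset.sum_le_sum fun s _ => ?_)
  rw [norm_smul, Real.norm_eq_abs]
  exact mul_le_mul_of_nonneg_left (hv s) (abs_nonneg _)

theorem norm_average_le {ι E : Type*} [Fintype ι] [NormedAddCommGroup E] [NormedSpace ℝ E] {p : ι → ℝ}
    (hp : p ∈ stdSimplex ℝ ι) {v : ι → E} {C : ℝ} (hv : ∀ s, ‖v s‖ ≤ C) :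
    ‖∑ s, p s • v s‖ ≤ C := by
  have h : ∑ s, |p s| = 1 := by
    rw [← hp.2]
    exact Finset.sum_congr rfl fun s _ => abs_of_nonneg (hp.1 s)
  simpa [h] using norm_sum_smul_le p hv

/-! ### TD directions, mixing time and drift -/

namespace PolicyEval

open Matrix Filter Topology

variable {S : Type*} [Fintype S] [DecidableEq S] {K : ℕ} {M : PolicyEval S K} {rbar : ℝ}
  {π : S → ℝ} {ωmin : ℝ}

namespace Standing

theorem norm_feature_le (hM : M.Standing rbar) (s : S) : ‖M.φ s‖ ≤ 1 := by
  have := hM.features_norm s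
  nlinarith [norm_nonneg (M.φ s)]

theorem abs_inner_feature_le (hM : M.Standing rbar) (s : S) (θ : EuclideanSpace ℝ (Fin K)) :
    |inner ℝ (M.φ s) θ| ≤ ‖θ‖ :=
  (abs_real_inner_le_norm _ _).trans
    (mul_le_of_le_one_left (norm_nonneg _) (hM.norm_feature_le s))

theorem norm_smul_feature_le (hM : M.Standing rbar) (s : S) (a : ℝ) : ‖a • M.φ s‖ ≤ |a| := by
  rw [norm_smul, Real.norm_eq_abs]
  exact mul_le_of_le_one_right (abs_nonneg _) (hM.norm_feature_le s)

theorem norm_tdDir_le (hM : M.Standing rbar) (s s' : S) (θ : EuclideanSpace ℝ (Fin K)) :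
    ‖M.tdDir s s' θ‖ ≤ rbar + 2 * ‖θ‖ := by
  refine (hM.norm_smul_feature_le s _).trans ?_
  have h1 := abs_le.1 (hM.reward_bound s)
  have h2 := abs_le.1 (hM.abs_inner_feature_le s θ)
  have h3 := abs_le.1 (hM.abs_inner_feature_le s' θ)
  have h4 := hM.γ_pos
  have h5 := hM.γ_lt_one
  have h6 := norm_nonneg θ
  rw [abs_le]
  constructor <;> nlinarith

theorem norm_tdDir_sub_le (hM : M.Standing rbar) (s s' : S)
    (θ θ' : EuclideanSpace ℝ (Fin K)) :
    ‖M.tdDir s s' θ - M.tdDir s s' θ'‖ ≤ 2 * ‖θ - θ'‖ := by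
  have h : M.tdDir s s' θ - M.tdDir s s' θ'
      = (M.γ * inner ℝ (M.φ s') (θ - θ') - inner ℝ (M.φ s) (θ - θ')) • M.φ s := by
    simp only [tdDir, ← sub_smul, inner_sub_right]
    congr 1
    ring
  rw [h]
  refine (hM.norm_smul_feature_le s _).trans ?_
  have h2 := abs_le.1 (hM.abs_inner_feature_le s (θ - θ'))
  have h3 := abs_le.1 (hM.abs_inner_feature_le s' (θ - θ'))
  have h4 := hM.γ_pos
  have h5 := hM.γ_lt_one
  have h6 := norm_nonneg (θ - θ')
  rw [abs_le]
  constructor <;> nlinarith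

theorem row_mem_stdSimplex (hM : M.Standing rbar) (s : S) : M.P s ∈ stdSimplex ℝ S :=
  ⟨fun _ => nonneg_of_mem_rowStochastic hM.stochastic,
    sum_row_of_mem_rowStochastic hM.stochastic s⟩

theorem norm_meanDir_le (hM : M.Standing rbar) (hπ : M.IsStationary π)
    (θ : EuclideanSpace ℝ (Fin K)) : ‖M.meanDir π θ‖ ≤ rbar + 2 * ‖θ‖ :=
  norm_average_le hπ.1 fun s => norm_average_le (hM.row_mem_stdSimplex s) fun s' =>
    hM.norm_tdDir_le s s' θ

theorem norm_meanDir_sub_le (hM : M.Standing rbar) (hπ : M.IsStationary π)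
    (θ θ' : EuclideanSpace ℝ (Fin K)) :
    ‖M.meanDir π θ - M.meanDir π θ'‖ ≤ 2 * ‖θ - θ'‖ := by
  simp only [meanDir, ← Finset.sum_sub_distrib, ← smul_sub]
  exact norm_average_le hπ.1 fun s => norm_average_le (hM.row_mem_stdSimplex s) fun s' =>
    hM.norm_tdDir_sub_le s s' θ θ'

theorem norm_condDir_sub_meanDir_le (hM : M.Standing rbar) (k : ℕ) (s₀ : S)
    (θ : EuclideanSpace ℝ (Fin K)) :
    ‖M.condDir k s₀ θ - M.meanDir π θ‖
      ≤ (∑ s, |(M.P ^ k) s₀ s - π s|) * (rbar + 2 * ‖θ‖) := by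
  simp only [condDir, meanDir, ← Finset.sum_sub_distrib, ← sub_smul]
  exact norm_sum_smul_le _ fun s => norm_average_le (hM.row_mem_stdSimplex s) fun s' =>
    hM.norm_tdDir_le s s' θ

/-- The mixing time is finite at every positive precision. -/
theorem exists_isMixingTime (hM : M.Standing rbar) (hπ : M.IsStationary π) (hr : 0 ≤ rbar)
    {ε : ℝ} (hε : 0 < ε) : ∃ τ, M.IsMixingTime π ε τ := by
  -- The threshold matches `rbar + 2‖θ‖ ≤ (rbar + 2)(‖θ‖ + 1)`, which makes one time serve every
  -- `θ`.
  have h : ∀ᶠ k in atTop, ∀ s₀, ∑ s, |(M.P ^ k) s₀ s - π s| < ε / (rbar + 2) :=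
    eventually_all.2 fun s₀ =>
      (tendsto_sum_abs_pow_sub hM.stochastic hM.irreducible hM.aperiodic hπ.1 hπ.2 s₀).eventually
        (gt_mem_nhds (by positivity))
  obtain ⟨N, hN⟩ := eventually_atTop.1 h
  have hex : ∃ t : ℕ, 1 ≤ t ∧ ∀ k, t ≤ k → ∀ (θ : EuclideanSpace ℝ (Fin K)) (s₀ : S),
      ‖M.condDir k s₀ θ - M.meanDir π θ‖ ≤ ε * (‖θ‖ + 1) := by
    refine ⟨N + 1, by omega, fun k hk θ s₀ => ?_⟩
    refine (hM.norm_condDir_sub_meanDir_le k s₀ θ).trans ?_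
    calc (∑ s, |(M.P ^ k) s₀ s - π s|) * (rbar + 2 * ‖θ‖)
        ≤ (ε / (rbar + 2)) * ((rbar + 2) * (‖θ‖ + 1)) := by
          gcongr
          · exact (hN k (by omega) s₀).le
          · nlinarith [norm_nonneg θ]
      _ = ε * (‖θ‖ + 1) := by field_simp
  classical
  exact ⟨Nat.find hex, Nat.find_spec hex, fun t ht => Nat.find_min' hex ht⟩

end Standing

theorem valueApprox_mem_span {S : Type*} {M : PolicyEval S K} (θ : EuclideanSpace ℝ (Fin K)) :
    M.valueApprox θ ∈ Submodule.span ℝ (Set.range fun (k : Fin K) (s : S) => M.φ s k) := by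
  have h : M.valueApprox θ = ∑ k, θ k • fun s : S => M.φ s k := by
    funext s
    simp [valueApprox, PiLp.inner_apply, Finset.sum_apply]
  rw [h]
  exact Submodule.sum_mem _ fun k _ => Submodule.smul_mem _ _ (Submodule.subset_span ⟨k, rfl⟩)

/-- The mean direction is `Φᵀ D` applied to the Bellman residual; this is the link with the
projected Bellman equation. -/
theorem Standing.inner_meanDir (hM : M.Standing rbar) (θ w : EuclideanSpace ℝ (Fin K)) :
    inner ℝ (M.meanDir π θ) w
      = ∑ s, π s * (M.bellman (M.valueApprox θ) s - M.valueApprox θ s) * M.valueApprox w s := by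
  simp only [meanDir, sum_inner, inner_smul_left, conj_trivial, tdDir, bellman, valueApprox]
  refine Finset.sum_congr rfl fun s _ => ?_
  rw [mul_assoc]
  congr 1
  have h1 := (hM.row_mem_stdSimplex s).2
  calc ∑ s', M.P s s' * ((M.R s + M.γ * inner ℝ (M.φ s') θ - inner ℝ (M.φ s) θ)
          * inner ℝ (M.φ s) w)
      = ((∑ s', M.P s s') * M.R s + M.γ * ∑ s', M.P s s' * inner ℝ (M.φ s') θ
          - (∑ s', M.P s s') * inner ℝ (M.φ s) θ) * inner ℝ (M.φ s) w := by
        rw [Finset.sum_mul, Finset.sum_mul, Finset.mul_sum, ← Finset.sum_add_distrib,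
          ← Finset.sum_sub_distrib, Finset.sum_mul]
        exact Finset.sum_congr rfl fun s' _ => by ring
    _ = _ := by rw [h1, one_mul, one_mul]

theorem dotProduct_Sigma_mulVec (M : PolicyEval S K) (π : S → ℝ) (v : Fin K → ℝ) :
    v ⬝ᵥ (M.Sigma π *ᵥ v) = ∑ s, π s * M.valueApprox (WithLp.toLp 2 v) s ^ 2 := by
  have h : M.Phi *ᵥ v = M.valueApprox (WithLp.toLp 2 v) := by
    funext s
    simp [Phi, valueApprox, mulVec, dotProduct, PiLp.inner_apply, mul_comm]
  rw [Sigma, ← mulVec_mulVec, ← mulVec_mulVec, h, dotProduct_mulVec, vecMul_transpose, h]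
  simp only [dotProduct, mulVec_diagonal]
  exact Finset.sum_congr rfl fun s _ => by ring

theorem isHermitian_Sigma (M : PolicyEval S K) (π : S → ℝ) : (M.Sigma π).IsHermitian := by
  simp [IsHermitian, Sigma, Matrix.mul_assoc]

/-- Rayleigh bound: eigenvalues of `Σ - ωmin` are eigenvalues of `Σ` shifted by `-ωmin`, so this
symmetric matrix is positive semidefinite. -/
theorem IsSmallestEigenvalue.mul_norm_sq_le (h : M.IsSmallestEigenvalue π ωmin)
    (w : EuclideanSpace ℝ (Fin K)) :
    ωmin * ‖w‖ ^ 2 ≤ ∑ s, π s * M.valueApprox w s ^ 2 := by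
  have hH : (M.Sigma π - ωmin • 1).IsHermitian :=
    (isHermitian_Sigma M π).sub (by simp [IsHermitian])
  have hpsd : (M.Sigma π - ωmin • 1).PosSemidef := by
    rw [hH.posSemidef_iff_eigenvalues_nonneg]
    intro i
    have hv := hH.mulVec_eigenvectorBasis i
    have hne : (hH.eigenvectorBasis i).ofLp ≠ 0 := by
      intro h0
      have := hH.eigenvectorBasis.orthonormal.ne_zero i
      exact this (by ext k; simpa using congrFun h0 k)
    have hmem : hH.eigenvalues i + ωmin ∈
        {l : ℝ | Module.End.HasEigenvalue (Matrix.toLin' (M.Sigma π)) l} := by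
      refine Module.End.hasEigenvalue_of_hasEigenvector (x := (hH.eigenvectorBasis i).ofLp)
        (Module.End.hasEigenvector_iff.2 ⟨?_, hne⟩)
      rw [Module.End.mem_eigenspace_iff, toLin'_apply, add_smul, ← sub_eq_iff_eq_add]
      simpa [sub_mulVec, smul_mulVec] using hv
    have := h.2 hmem
    show 0 ≤ hH.eigenvalues i
    linarith
  have h2 := hpsd.dotProduct_mulVec_nonneg w.ofLp
  rw [sub_mulVec, dotProduct_sub, star_trivial, dotProduct_Sigma_mulVec, smul_mulVec,
    one_mulVec, dotProduct_smul] at h2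
  have h3 : w.ofLp ⬝ᵥ w.ofLp = ‖w‖ ^ 2 := by
    rw [EuclideanSpace.real_norm_sq_eq]
    simp [dotProduct, sq]
  rw [h3, smul_eq_mul] at h2
  linarith

theorem IsSmallestEigenvalue.exists_eigenvector (h : M.IsSmallestEigenvalue π ωmin) :
    ∃ w : EuclideanSpace ℝ (Fin K), w ≠ 0 ∧
      ωmin * ‖w‖ ^ 2 = ∑ s, π s * M.valueApprox w s ^ 2 := by
  obtain ⟨v, hv⟩ := h.1.exists_hasEigenvector
  refine ⟨WithLp.toLp 2 v, by simpa using hv.2, ?_⟩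
  rw [← dotProduct_Sigma_mulVec, ← toLin'_apply, hv.apply_eq_smul, dotProduct_smul,
    EuclideanSpace.real_norm_sq_eq]
  simp [dotProduct, sq]

namespace Standing

theorem valueApprox_ne_zero (hM : M.Standing rbar) {w : EuclideanSpace ℝ (Fin K)} (hw : w ≠ 0) :
    ∃ s, M.valueApprox w s ≠ 0 := by
  by_contra! h
  have h0 : ∑ k, w k • (fun s : S => M.φ s k) = 0 := by
    funext s
    simpa [valueApprox, PiLp.inner_apply, Finset.sum_apply] using h s
  exact hw (by ext k; exact Fintype.linearIndependent_iff.1 hM.features_indep _ h0 k)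

/-- At an eigenvector `w`, independence makes `Φ w` nonzero and `π` has full support. -/
theorem smallestEigenvalue_pos (hM : M.Standing rbar) (hπ : M.IsStationary π)
    (h : M.IsSmallestEigenvalue π ωmin) : 0 < ωmin := by
  obtain ⟨w, hw, heq⟩ := h.exists_eigenvector
  obtain ⟨s, hs⟩ := hM.valueApprox_ne_zero hw
  have hpos : ∀ s, 0 < π s := stationary_pos hM.irreducible hM.aperiodic hπ.1 hπ.2
  have h1 : 0 < ∑ s, π s * M.valueApprox w s ^ 2 :=
    Finset.sum_pos' (fun i _ => mul_nonneg (hpos i).le (sq_nonneg _))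
      ⟨s, Finset.mem_univ s, mul_pos (hpos s) (by positivity)⟩
  rw [← heq] at h1
  exact pos_of_mul_pos_left h1 (sq_nonneg _)

theorem smallestEigenvalue_le_one (hM : M.Standing rbar) (hπ : M.IsStationary π)
    (h : M.IsSmallestEigenvalue π ωmin) : ωmin ≤ 1 := by
  obtain ⟨w, hw, heq⟩ := h.exists_eigenvector
  have h1 : ∑ s, π s * M.valueApprox w s ^ 2 ≤ ∑ s, π s * ‖w‖ ^ 2 :=
    Finset.sum_le_sum fun s _ => mul_le_mul_of_nonneg_left
      (sq_le_sq' (abs_le.1 (hM.abs_inner_feature_le s w)).1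
        (abs_le.1 (hM.abs_inner_feature_le s w)).2) (hπ.1.1 s)
  rw [← Finset.sum_mul, hπ.1.2, ← heq] at h1
  exact le_of_mul_le_mul_right h1 (by positivity)

/-- The mean direction is strongly monotone towards the fixed point. -/
theorem inner_sub_meanDir_le (hM : M.Standing rbar) (hπ : M.IsStationary π)
    (hω : M.IsSmallestEigenvalue π ωmin) {θstar : EuclideanSpace ℝ (Fin K)}
    (hstar : M.SolvesProjectedBellman π θstar) (θ : EuclideanSpace ℝ (Fin K)) :
    inner ℝ (θ - θstar) (M.meanDir π θ) ≤ -((1 - M.γ) * ωmin * ‖θ - θstar‖ ^ 2) := by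
  set w := θ - θstar with hw
  -- The Bellman residual at `θstar` is `D`-orthogonal to the span of the features.
  have h0 : inner ℝ (M.meanDir π θstar) w = 0 := by
    rw [hM.inner_meanDir]
    exact hstar.2 _ (valueApprox_mem_span w)
  have hV : ∀ s, M.valueApprox θ s = M.valueApprox θstar s + M.valueApprox w s := by
    intro s
    simp only [valueApprox, hw, inner_sub_right]
    ring
  have h1 : inner ℝ (M.meanDir π θ) w = M.γ * ∑ s, π s * ∑ s', M.P s s' *
      (M.valueApprox w s' * M.valueApprox w s) - ∑ s, π s * M.valueApprox w s ^ 2 := by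
    rw [← sub_zero (inner ℝ (M.meanDir π θ) w), ← h0, hM.inner_meanDir, hM.inner_meanDir,
      ← Finset.sum_sub_distrib, Finset.mul_sum, ← Finset.sum_sub_distrib]
    refine Finset.sum_congr rfl fun s _ => ?_
    simp only [bellman, hV, mul_add, Finset.sum_add_distrib, ← mul_assoc, ← Finset.sum_mul]
    ring
  -- This is `⟨PV, V⟩_D ≤ ‖V‖_D²`: by AM-GM each product splits into two half squares, and
  -- stationarity gives the next state the law `π` again.
  have h2 : ∑ s, π s * ∑ s', M.P s s' * (M.valueApprox w s' * M.valueApprox w s)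
      ≤ ∑ s, π s * M.valueApprox w s ^ 2 := by
    have h3 : ∑ s, π s * ∑ s', M.P s s' * (M.valueApprox w s' * M.valueApprox w s)
        ≤ ∑ s, π s * ∑ s', M.P s s' *
          (M.valueApprox w s' ^ 2 / 2 + M.valueApprox w s ^ 2 / 2) := by
      refine Finset.sum_le_sum fun s _ => mul_le_mul_of_nonneg_left
        (Finset.sum_le_sum fun s' _ => mul_le_mul_of_nonneg_left ?_
          ((hM.row_mem_stdSimplex s).1 s')) (hπ.1.1 s)
      nlinarith [sq_nonneg (M.valueApprox w s' - M.valueApprox w s)]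
    have h4 : ∑ s, π s * ∑ s', M.P s s' * (M.valueApprox w s' ^ 2 / 2)
        = ∑ s', π s' * (M.valueApprox w s' ^ 2 / 2) := by
      simp only [Finset.mul_sum]
      rw [Finset.sum_comm]
      refine Finset.sum_congr rfl fun s' _ => ?_
      have h5 := congrFun hπ.2 s'
      simp only [vecMul, dotProduct] at h5
      simp only [← mul_assoc, ← Finset.sum_mul, h5]
    have h6 : ∑ s, π s * ∑ s', M.P s s' * (M.valueApprox w s ^ 2 / 2)
        = ∑ s, π s * (M.valueApprox w s ^ 2 / 2) :=
      Finset.sum_congr rfl fun s _ => by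
        rw [← Finset.sum_mul, (hM.row_mem_stdSimplex s).2, one_mul]
    refine h3.trans (le_of_eq ?_)
    simp only [mul_add, Finset.sum_add_distrib] at h4 h6 ⊢
    rw [h4, h6, ← Finset.sum_add_distrib]
    exact Finset.sum_congr rfl fun s _ => by ring
  have h7 := hω.mul_norm_sq_le w
  have h8 := hM.γ_pos
  have h9 := hM.γ_lt_one
  rw [real_inner_comm, h1]
  nlinarith [mul_le_mul_of_nonneg_left h2 h8.le, mul_le_mul_of_nonneg_left h7 (sub_nonneg.2 h9.le)]

end Standing

end PolicyEval

/-! ### Expectations along the chain as finite sums -/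

section PathExpectation

open Matrix

theorem integral_comp_of_fintype {Ω Y : Type*} [MeasurableSpace Ω] {μ : Measure Ω}
    [IsFiniteMeasure μ] [Fintype Y] [MeasurableSpace Y] [MeasurableSingletonClass Y]
    {f : Ω → Y} (hf : Measurable f) (F : Y → ℝ) :
    ∫ ω, F (f ω) ∂μ = ∑ y, μ.real (f ⁻¹' {y}) * F y := by
  rw [← integral_map (φ := f) (f := F) hf.aemeasurable
    (measurable_of_finite F).aestronglyMeasurable, integral_fintype .of_finite]
  simp only [smul_eq_mul, map_measureReal_apply hf (measurableSet_singleton _)]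

theorem integrable_comp_of_finite {Ω Y : Type*} [MeasurableSpace Ω] {μ : Measure Ω}
    [IsFiniteMeasure μ] [Finite Y] [MeasurableSpace Y] [MeasurableSingletonClass Y]
    {f : Ω → Y} (hf : Measurable f) (F : Y → ℝ) : Integrable (fun ω => F (f ω)) μ :=
  (Integrable.of_finite (f := F) (μ := μ.map f)).comp_measurable hf

/-- The path that follows `p` up to time `t` and stays put afterwards. -/
def stoppedPath {S : Type*} (t : ℕ) (p : Fin (t + 1) → S) : ℕ → S :=
  fun i => p ⟨min i t, by omega⟩

/-- A functional of the path up to `t` factors through the finite type `Fin (t + 1) → S`. This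
replaces conditional expectations by finite sums. -/
theorem DependsOn.apply_stoppedPath {S β : Type*} {t : ℕ} {F : (ℕ → S) → β}
    (hF : DependsOn F (Set.Iic t)) (x : ℕ → S) :
    F (stoppedPath t fun i => x i) = F x :=
  hF fun i hi => by simp [stoppedPath, min_eq_left (Set.mem_Iic.1 hi)]

namespace IsMarkovChain

variable {S Ω : Type*} [Fintype S] [MeasurableSpace S] [MeasurableSingletonClass S]
  [MeasurableSpace Ω] {μ : Measure Ω} [IsFiniteMeasure μ] {P : Matrix S S ℝ} {s : ℕ → Ω → S}

theorem measurable_initial {S Ω : Type*} [MeasurableSpace S] [MeasurableSpace Ω]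
    {μ : Measure Ω} {P : Matrix S S ℝ} {s : ℕ → Ω → S} (hs : IsMarkovChain μ P s) (t : ℕ) :
    Measurable fun ω (i : Fin (t + 1)) => s i ω :=
  measurable_pi_lambda _ fun i => hs.measurable i

theorem integrable_of_dependsOn (hs : IsMarkovChain μ P s) {t : ℕ} {F : (ℕ → S) → ℝ}
    (hF : DependsOn F (Set.Iic t)) : Integrable (fun ω => F fun i => s i ω) μ := by
  simp only [← hF.apply_stoppedPath (fun i => s i _)]
  exact integrable_comp_of_finite (hs.measurable_initial t) fun p => F (stoppedPath t p)

/-- Averaging out the next state of the chain, given the path so far. -/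
theorem integral_next (hs : IsMarkovChain μ P s) {t : ℕ} {H : (ℕ → S) → S → ℝ}
    (hH : DependsOn H (Set.Iic t)) :
    ∫ ω, H (fun i => s i ω) (s (t + 1) ω) ∂μ
      = ∫ ω, ∑ y, P (s t ω) y * H (fun i => s i ω) y ∂μ := by
  have hF : DependsOn (fun x : ℕ → S => ∑ y, P (x t) y * H x y) (Set.Iic t) := fun x x' h => by
    simp only [hH h, h t (Set.mem_Iic.2 le_rfl)]
  simp only [← hH.apply_stoppedPath (fun i => s i _)]
  rw [integral_comp_of_fintype
      (f := fun ω => ((fun i : Fin (t + 1) => s i ω), s (t + 1) ω))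
      ((hs.measurable_initial t).prodMk (hs.measurable (t + 1)))
      (fun q => H (stoppedPath t q.1) q.2),
    integral_comp_of_fintype (f := fun ω (i : Fin (t + 1)) => s i ω)
      (hs.measurable_initial t) fun p => ∑ y, P (p ⟨t, by omega⟩) y * H (stoppedPath t p) y,
    Fintype.sum_prod_type]
  refine Finset.sum_congr rfl fun p _ => ?_
  rw [Finset.mul_sum]
  refine Finset.sum_congr rfl fun y _ => ?_
  rw [← mul_assoc]
  congr 1
  -- The Markov property for the path `p` continued by `y` is the required identity of weights.
  have hstep := hs.step t fun i => if i ≤ t then stoppedPath t p i else y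
  have h1 : ∀ ω, ((fun i : Fin (t + 1) => s i ω) = p) ↔ ∀ i ≤ t, s i ω = stoppedPath t p i := by
    intro ω
    refine ⟨fun h i hi => ?_, fun h => funext fun i => ?_⟩
    · simp [stoppedPath, ← h, min_eq_left hi]
    · have := h i (by omega)
      simpa [stoppedPath, min_eq_left (show (i : ℕ) ≤ t by omega)] using this
  have e1 : {ω | ∀ i ≤ t + 1, s i ω = if i ≤ t then stoppedPath t p i else y}
      = (fun ω => ((fun i : Fin (t + 1) => s i ω), s (t + 1) ω)) ⁻¹' {(p, y)} := by
    ext ω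
    simp only [Set.mem_ofPred_eq, Set.mem_preimage, Set.mem_singleton_iff, Prod.mk.injEq, h1]
    refine ⟨fun h => ⟨fun i hi => ?_, by simpa using h (t + 1) le_rfl⟩, fun h i hi => ?_⟩
    · simpa [hi] using h i (by omega)
    · split_ifs with h2
      · exact h.1 i h2
      · rw [show i = t + 1 by omega, h.2]
  have e2 : {ω | ∀ i ≤ t, s i ω = if i ≤ t then stoppedPath t p i else y}
      = (fun ω (i : Fin (t + 1)) => s i ω) ⁻¹' {p} := by
    ext ω
    simp only [Set.mem_ofPred_eq, Set.mem_preimage, Set.mem_singleton_iff, h1]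
    exact forall₂_congr fun i hi => by rw [if_pos hi]
  rw [e1, e2] at hstep
  simpa [stoppedPath] using hstep

/-- Averaging out the state of the chain `k` steps ahead, given the path so far. -/
theorem integral_add [DecidableEq S] (hs : IsMarkovChain μ P s) {t : ℕ} (k : ℕ)
    {H : (ℕ → S) → S → ℝ} (hH : DependsOn H (Set.Iic t)) :
    ∫ ω, H (fun i => s i ω) (s (t + k) ω) ∂μ
      = ∫ ω, ∑ y, (P ^ k) (s t ω) y * H (fun i => s i ω) y ∂μ := by
  -- Averaging out the last transition changes `H`, so the hypothesis is needed for all `H`.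
  induction k generalizing H with
  | zero => simp [Matrix.one_apply]
  | succ k ih =>
    have h1 : DependsOn H (Set.Iic (t + k)) := fun x x' h =>
      hH fun i hi => h i ((Set.mem_Iic.1 hi).trans (by omega))
    have h2 : DependsOn (fun (x : ℕ → S) z => ∑ y, P z y * H x y) (Set.Iic t) :=
      fun x x' h => by simp only [hH h]
    rw [← add_assoc, hs.integral_next h1, ih h2]
    congr 1
    funext ω
    simp only [pow_succ, mul_apply, Finset.mul_sum, Finset.sum_mul, ← mul_assoc]
    exact Finset.sum_comm

/-- Averaging out the transition of the chain `k` steps ahead, given the path so far. -/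
theorem integral_add_transition [DecidableEq S] (hs : IsMarkovChain μ P s) {t : ℕ} (k : ℕ)
    {H : (ℕ → S) → S → S → ℝ} (hH : DependsOn H (Set.Iic t)) :
    ∫ ω, H (fun i => s i ω) (s (t + k) ω) (s (t + k + 1) ω) ∂μ
      = ∫ ω, ∑ y, (P ^ k) (s t ω) y * ∑ z, P y z * H (fun i => s i ω) y z ∂μ := by
  have h1 : DependsOn (fun (x : ℕ → S) z => H x (x (t + k)) z) (Set.Iic (t + k)) :=
    fun x x' h => by
      beta_reduce
      rw [hH fun i hi => h i ((Set.mem_Iic.1 hi).trans (by omega)),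
        h (t + k) (Set.mem_Iic.2 le_rfl)]
  have h2 : DependsOn (fun (x : ℕ → S) y => ∑ z, P y z * H x y z) (Set.Iic t) :=
    fun x x' h => by simp only [hH h]
  rw [hs.integral_next h1]
  exact hs.integral_add k h2

end IsMarkovChain

end PathExpectation

/-! ### One projected step with error feedback -/

section ErrorFeedback

variable {E : Type*} [NormedAddCommGroup E] [InnerProductSpace ℝ E]

theorem IsNearestPoint.inner_le_zero {B : Set E} (hB : Convex ℝ B) {x y : E}
    (h : IsNearestPoint B x y) {z : E} (hz : z ∈ B) : inner ℝ (x - y) (z - y) ≤ 0 := by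
  refine (norm_eq_iInf_iff_real_inner_le_zero hB h.1).1 (le_antisymm ?_ ?_) z hz
  · have : Nonempty B := ⟨⟨y, h.1⟩⟩
    exact le_ciInf fun w => h.2 w w.2
  · exact ciInf_le ⟨0, by rintro _ ⟨w, rfl⟩; exact norm_nonneg _⟩ (⟨y, h.1⟩ : B)

/-- One projected step with error feedback, measured at the perturbed iterates
`θ + α • e` and `y + α • (e + g - h)`. -/
theorem IsNearestPoint.norm_sq_errorFeedback_le {B : Set E} (hB : Convex ℝ B) {α : ℝ}
    {θ e g h y z : E} (hy : IsNearestPoint B (θ + α • h) y) (hz : z ∈ B) :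
    ‖y + α • (e + g - h) - z‖ ^ 2 ≤ ‖θ + α • e - z‖ ^ 2 + 2 * α * inner ℝ (θ - z) g
      + 2 * α ^ 2 * inner ℝ e g + α ^ 2 * ‖g‖ ^ 2 + α ^ 2 * ‖e + g - h‖ ^ 2 := by
  set b := θ + α • h - y with hb
  set f := α • (e + g - h) with hf
  have h1 : 0 ≤ inner ℝ (y - z) b := by
    have := hy.inner_le_zero hB hz
    rw [← neg_sub y z, inner_neg_right, real_inner_comm] at this
    linarith
  have h2 : ‖y - z + f + b‖ ^ 2 = ‖y - z + f‖ ^ 2 + 2 * inner ℝ (y - z + f) b + ‖b‖ ^ 2 :=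
    norm_add_sq_real _ _
  have h3 : ‖f + b‖ ^ 2 = ‖f‖ ^ 2 + 2 * inner ℝ f b + ‖b‖ ^ 2 := norm_add_sq_real _ _
  have h4 : y - z + f + b = (θ + α • e - z) + α • g := by
    rw [hf, hb, smul_sub, smul_add]
    abel
  have h5 : ‖(θ + α • e - z) + α • g‖ ^ 2
      = ‖θ + α • e - z‖ ^ 2 + 2 * inner ℝ (θ + α • e - z) (α • g) + ‖α • g‖ ^ 2 :=
    norm_add_sq_real _ _
  have h6 : inner ℝ (θ + α • e - z) (α • g)
      = α * inner ℝ (θ - z) g + α ^ 2 * inner ℝ e g := by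
    rw [show θ + α • e - z = (θ - z) + α • e by abel, inner_add_left, inner_smul_right,
      inner_smul_right, inner_smul_left, conj_trivial]
    ring
  have h7 : ‖α • g‖ ^ 2 = α ^ 2 * ‖g‖ ^ 2 := by
    rw [norm_smul, mul_pow, Real.norm_eq_abs, sq_abs]
  have h8 : ‖f‖ ^ 2 = α ^ 2 * ‖e + g - h‖ ^ 2 := by
    rw [hf, norm_smul, mul_pow, Real.norm_eq_abs, sq_abs]
  rw [show y + f - z = y - z + f by abel]
  rw [inner_add_left] at h2
  rw [h4, h5, h6, h7] at h2
  nlinarith [sq_nonneg ‖f + b‖]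

end ErrorFeedback

/-! ### Contraction of compression residuals -/

section Compressor

variable {E : Type*} [NormedAddCommGroup E]

/-- Rests on `√(1 - 1/δ) ≤ 1 - 1/(2δ)`. -/
theorem IsCompressor.norm_residual_le {δ : ℝ} (hδ : 1 ≤ δ) {Q : E → E} (hQ : IsCompressor δ Q)
    (x : E) : ‖x - Q x‖ ≤ (1 - 1 / (2 * δ)) * ‖x‖ := by
  have h0 : 0 ≤ 1 - 1 / (2 * δ) := by
    rw [sub_nonneg, div_le_one (by linarith)]
    linarith
  refine le_of_sq_le_sq ?_ (by positivity)
  rw [norm_sub_rev]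
  refine (hQ x).trans ?_
  rw [mul_pow]
  gcongr
  have : (1 - 1 / (2 * δ)) ^ 2 = 1 - 1 / δ + (1 / (2 * δ)) ^ 2 := by
    field_simp
    ring
  rw [this]
  linarith [sq_nonneg (1 / (2 * δ))]

/-- `(2δ - 1) C` is the fixed point of `r ↦ (1 - 1/(2δ)) (r + C)`, hence an invariant radius for the
memory. -/
theorem IsCompressor.norm_residual_le_of_norm_le {δ : ℝ} (hδ : 1 ≤ δ) {Q : E → E}
    (hQ : IsCompressor δ Q) {e g : E} {C : ℝ} (he : ‖e‖ ≤ (2 * δ - 1) * C) (hg : ‖g‖ ≤ C) :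
    ‖e + g - Q (e + g)‖ ≤ (2 * δ - 1) * C := by
  have h0 : 0 ≤ 1 - 1 / (2 * δ) := by
    rw [sub_nonneg, div_le_one (by linarith)]
    linarith
  calc ‖e + g - Q (e + g)‖ ≤ (1 - 1 / (2 * δ)) * ‖e + g‖ := hQ.norm_residual_le hδ _
    _ ≤ (1 - 1 / (2 * δ)) * ((2 * δ - 1) * C + C) := by
      gcongr
      exact (norm_add_le _ _).trans (add_le_add he hg)
    _ = (2 * δ - 1) * C := by
      field_simp
      ring

theorem IsCompressor.norm_le {δ : ℝ} (hδ : 1 ≤ δ) {Q : E → E} (hQ : IsCompressor δ Q)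
    (x : E) : ‖Q x‖ ≤ 2 * ‖x‖ := by
  have h1 := hQ.norm_residual_le hδ x
  have h2 : ‖Q x‖ ≤ ‖x‖ + ‖x - Q x‖ := by
    simpa using norm_sub_le x (x - Q x)
  have h3 : 0 ≤ 1 / (2 * δ) * ‖x‖ := by positivity
  nlinarith

end Compressor

/-! ### Pathwise bounds for the algorithm -/

namespace PolicyEval

variable {S : Type*} [Fintype S] [DecidableEq S] {K : ℕ}

/-- The assumptions on the data of projected EF-TD. -/
structure EFTDSetting (M : PolicyEval S K) (rbar : ℝ) (π : S → ℝ)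
    (θstar : EuclideanSpace ℝ (Fin K)) (B : Set (EuclideanSpace ℝ (Fin K))) (G δ : ℝ)
    (Q : EuclideanSpace ℝ (Fin K) → EuclideanSpace ℝ (Fin K)) (α : ℝ)
    (θ₀ : EuclideanSpace ℝ (Fin K)) : Prop where
  standing : M.Standing rbar
  rbar_nonneg : 0 ≤ rbar
  stationary : M.IsStationary π
  convex : Convex ℝ B
  isCompact : IsCompact B
  one_le_G : 1 ≤ G
  subset_ball : B ⊆ Metric.closedBall 0 G
  fixedPoint_mem : θstar ∈ B
  init_mem : θ₀ ∈ B
  one_le_δ : 1 ≤ δ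
  compressor : IsCompressor δ Q
  α_pos : 0 < α

variable {M : PolicyEval S K} {rbar : ℝ} {π : S → ℝ} {θstar θ₀ : EuclideanSpace ℝ (Fin K)}
  {B : Set (EuclideanSpace ℝ (Fin K))} {G δ α ωmin : ℝ}
  {Q : EuclideanSpace ℝ (Fin K) → EuclideanSpace ℝ (Fin K)}

theorem dependsOn_efTD {S : Type*} (M : PolicyEval S K)
    (Q : EuclideanSpace ℝ (Fin K) → EuclideanSpace ℝ (Fin K))
    (B : Set (EuclideanSpace ℝ (Fin K))) (α : ℝ) (θ₀ : EuclideanSpace ℝ (Fin K)) (t : ℕ) :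
    DependsOn (fun x : ℕ → S => M.efTD Q B α θ₀ x t) (Set.Iic t) := by
  induction t with
  | zero => exact fun _ _ _ => rfl
  | succ t ih =>
    intro x x' h
    have h1 := ih fun i hi => h i ((Set.mem_Iic.1 hi).trans t.le_succ)
    beta_reduce at h1
    simp only [efTD, h1, h t (Set.mem_Iic.2 t.le_succ), h (t + 1) (Set.mem_Iic.2 le_rfl)]

namespace EFTDSetting

theorem norm_le (h : M.EFTDSetting rbar π θstar B G δ Q α θ₀) {θ : EuclideanSpace ℝ (Fin K)}
    (hθ : θ ∈ B) : ‖θ‖ ≤ G := by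
  simpa using h.subset_ball hθ

theorem norm_sub_fixedPoint_le (h : M.EFTDSetting rbar π θstar B G δ Q α θ₀)
    {θ : EuclideanSpace ℝ (Fin K)} (hθ : θ ∈ B) : ‖θ - θstar‖ ≤ 2 * G := by
  linarith [norm_sub_le θ θstar, h.norm_le hθ, h.norm_le h.fixedPoint_mem]

theorem norm_tdDir_le (h : M.EFTDSetting rbar π θstar B G δ Q α θ₀) (s s' : S)
    {θ : EuclideanSpace ℝ (Fin K)} (hθ : θ ∈ B) : ‖M.tdDir s s' θ‖ ≤ (rbar + 2) * G := by
  have h1 := h.standing.norm_tdDir_le s s' θ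
  have h2 := h.norm_le hθ
  nlinarith [h.one_le_G, h.rbar_nonneg]

theorem norm_meanDir_le (h : M.EFTDSetting rbar π θstar B G δ Q α θ₀)
    {θ : EuclideanSpace ℝ (Fin K)} (hθ : θ ∈ B) : ‖M.meanDir π θ‖ ≤ (rbar + 2) * G := by
  have h1 := h.standing.norm_meanDir_le h.stationary θ
  have h2 := h.norm_le hθ
  nlinarith [h.one_le_G, h.rbar_nonneg]

theorem isNearestPoint (h : M.EFTDSetting rbar π θstar B G δ Q α θ₀)
    (y : EuclideanSpace ℝ (Fin K)) : IsNearestPoint B y (setProj B y) :=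
  isNearestPoint_setProj h.isCompact ⟨_, h.init_mem⟩ y

theorem iterate_mem (h : M.EFTDSetting rbar π θstar B G δ Q α θ₀) (x : ℕ → S) (t : ℕ) :
    (M.efTD Q B α θ₀ x t).1 ∈ B := by
  cases t with
  | zero => exact h.init_mem
  | succ t => exact (h.isNearestPoint _).1

theorem norm_memory_le_sub (h : M.EFTDSetting rbar π θstar B G δ Q α θ₀) (x : ℕ → S) (t : ℕ) :
    ‖(M.efTD Q B α θ₀ x t).2‖ ≤ (2 * δ - 1) * ((rbar + 2) * G) := by
  induction t with
  | zero =>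
    have h1 := h.one_le_δ
    have h2 := h.one_le_G
    have h3 := h.rbar_nonneg
    have h4 : 0 ≤ 2 * δ - 1 := by linarith
    simp only [efTD, norm_zero]
    positivity
  | succ t ih =>
    exact h.compressor.norm_residual_le_of_norm_le h.one_le_δ ih
      (h.norm_tdDir_le _ _ (h.iterate_mem x t))

theorem norm_memory_le (h : M.EFTDSetting rbar π θstar B G δ Q α θ₀) (x : ℕ → S) (t : ℕ) :
    ‖(M.efTD Q B α θ₀ x t).2‖ ≤ 2 * δ * ((rbar + 2) * G) := by
  have h2 := h.one_le_G
  have h3 := h.rbar_nonneg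
  have h4 : 0 ≤ (rbar + 2) * G := by positivity
  linarith [h.norm_memory_le_sub x t]

/-- As `θ ∈ B`, the projection moves `θ + α h` by at most `‖α h‖`, so the whole step is at most `2
‖α h‖`; two more factors 2 come from `‖Q v‖ ≤ 2 ‖v‖` and `‖v‖ ≤ 2δC`, with `C = (rbar + 2) G`. -/
theorem norm_iterate_succ_sub_le (h : M.EFTDSetting rbar π θstar B G δ Q α θ₀) (x : ℕ → S)
    (t : ℕ) : ‖(M.efTD Q B α θ₀ x (t + 1)).1 - (M.efTD Q B α θ₀ x t).1‖
      ≤ 8 * α * δ * ((rbar + 2) * G) := by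
  set θ := (M.efTD Q B α θ₀ x t).1 with hθ
  set v := (M.efTD Q B α θ₀ x t).2 + M.tdDir (x t) (x (t + 1)) θ with hv
  have h1 : ‖v‖ ≤ 2 * δ * ((rbar + 2) * G) := by
    have := norm_add_le (M.efTD Q B α θ₀ x t).2 (M.tdDir (x t) (x (t + 1)) θ)
    linarith [h.norm_memory_le_sub x t, h.norm_tdDir_le (x t) (x (t + 1)) (h.iterate_mem x t)]
  have h2 := h.compressor.norm_le h.one_le_δ v
  have h3 : ‖α • Q v‖ ≤ 4 * α * δ * ((rbar + 2) * G) := by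
    rw [norm_smul, Real.norm_eq_abs, abs_of_pos h.α_pos]
    nlinarith [h.α_pos]
  have h4 : ‖(θ + α • Q v) - setProj B (θ + α • Q v)‖ ≤ ‖α • Q v‖ := by
    simpa using (h.isNearestPoint (θ + α • Q v)).2 θ (h.iterate_mem x t)
  have h5 : (M.efTD Q B α θ₀ x (t + 1)).1 = setProj B (θ + α • Q v) := rfl
  have h6 := norm_sub_le (α • Q v) ((θ + α • Q v) - setProj B (θ + α • Q v))
  rw [show α • Q v - ((θ + α • Q v) - setProj B (θ + α • Q v))
    = setProj B (θ + α • Q v) - θ by abel] at h6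
  rw [h5]
  linarith

theorem norm_iterate_add_sub_le (h : M.EFTDSetting rbar π θstar B G δ Q α θ₀) (x : ℕ → S)
    (t k : ℕ) : ‖(M.efTD Q B α θ₀ x (t + k)).1 - (M.efTD Q B α θ₀ x t).1‖
      ≤ 8 * α * δ * ((rbar + 2) * G) * k := by
  induction k with
  | zero => simp
  | succ k ih =>
    have h1 := h.norm_iterate_succ_sub_le x (t + k)
    have h2 := norm_sub_le_norm_sub_add_norm_sub (M.efTD Q B α θ₀ x (t + k + 1)).1
      (M.efTD Q B α θ₀ x (t + k)).1 (M.efTD Q B α θ₀ x t).1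
    rw [← add_assoc]
    push_cast
    linarith

/-- One step of the algorithm along a path, up to the noise of the temporal difference. -/
theorem norm_sq_succ_le (h : M.EFTDSetting rbar π θstar B G δ Q α θ₀)
    (hω : M.IsSmallestEigenvalue π ωmin) (hstar : M.SolvesProjectedBellman π θstar)
    (hα : α ≤ 1) (x : ℕ → S) (t : ℕ) :
    ‖(M.efTD Q B α θ₀ x (t + 1)).1 + α • (M.efTD Q B α θ₀ x (t + 1)).2 - θstar‖ ^ 2
      ≤ (1 - α * ωmin * (1 - M.γ))
          * ‖(M.efTD Q B α θ₀ x t).1 + α • (M.efTD Q B α θ₀ x t).2 - θstar‖ ^ 2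
        + 2 * α * inner ℝ ((M.efTD Q B α θ₀ x t).1 - θstar)
          (M.tdDir (x t) (x (t + 1)) (M.efTD Q B α θ₀ x t).1
            - M.meanDir π (M.efTD Q B α θ₀ x t).1)
        + 17 * (α ^ 2 * δ ^ 2 * ((rbar + 2) * G) ^ 2) := by
  have he' := h.norm_memory_le x (t + 1)
  have he := h.norm_memory_le x t
  have hg := h.norm_tdDir_le (x t) (x (t + 1)) (h.iterate_mem x t)
  have hstep := (h.isNearestPoint ((M.efTD Q B α θ₀ x t).1
    + α • Q ((M.efTD Q B α θ₀ x t).2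
      + M.tdDir (x t) (x (t + 1)) (M.efTD Q B α θ₀ x t).1))).norm_sq_errorFeedback_le
    h.convex (e := (M.efTD Q B α θ₀ x t).2)
    (g := M.tdDir (x t) (x (t + 1)) (M.efTD Q B α θ₀ x t).1) h.fixedPoint_mem
  change ‖(M.efTD Q B α θ₀ x (t + 1)).1 + α • (M.efTD Q B α θ₀ x (t + 1)).2 - θstar‖ ^ 2
    ≤ _ + α ^ 2 * ‖(M.efTD Q B α θ₀ x (t + 1)).2‖ ^ 2 at hstep
  have hdrift := h.standing.inner_sub_meanDir_le h.stationary hω hstar (M.efTD Q B α θ₀ x t).1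
  generalize (M.efTD Q B α θ₀ x (t + 1)).2 = e' at *
  generalize (M.efTD Q B α θ₀ x (t + 1)).1 = θ' at *
  generalize (M.efTD Q B α θ₀ x t).2 = e at *
  generalize (M.efTD Q B α θ₀ x t).1 = θ at *
  generalize M.tdDir (x t) (x (t + 1)) θ = g at *
  have hω0 := h.standing.smallestEigenvalue_pos h.stationary hω
  have hω1 := h.standing.smallestEigenvalue_le_one h.stationary hω
  have hγ0 := h.standing.γ_pos
  have hγ1 := h.standing.γ_lt_one
  have hδ := h.one_le_δ
  have hα0 := h.α_pos
  have hC : 0 ≤ (rbar + 2) * G := by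
    have h2 := h.one_le_G
    have h3 := h.rbar_nonneg
    positivity
  generalize (rbar + 2) * G = C at *
  set m := ωmin * (1 - M.γ) with hm
  have hm0 : 0 ≤ m := mul_nonneg hω0.le (by linarith)
  have hm1 : m ≤ 1 := by nlinarith
  have hδC : C ≤ δ * C := by nlinarith
  have b1 : inner ℝ e g ≤ 2 * (δ * C) ^ 2 := by
    have := real_inner_le_norm e g
    have h2 : ‖e‖ * ‖g‖ ≤ (2 * δ * C) * C := by gcongr
    nlinarith [mul_nonneg (by linarith : (0:ℝ) ≤ δ) hC]
  have b2 : ‖g‖ ^ 2 ≤ (δ * C) ^ 2 := by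
    have := hg.trans hδC
    gcongr
  have b3 : ‖e'‖ ^ 2 ≤ 4 * (δ * C) ^ 2 := by
    calc ‖e'‖ ^ 2 ≤ (2 * δ * C) ^ 2 := by gcongr
      _ = _ := by ring
  have b4 : ‖e‖ ^ 2 ≤ 4 * (δ * C) ^ 2 := by
    calc ‖e‖ ^ 2 ≤ (2 * δ * C) ^ 2 := by gcongr
      _ = _ := by ring
  have b5 : ‖θ + α • e - θstar‖ ^ 2 ≤ 2 * ‖θ - θstar‖ ^ 2 + 2 * (α ^ 2 * ‖e‖ ^ 2) := by
    have h1 : ‖θ + α • e - θstar‖ ≤ ‖θ - θstar‖ + α * ‖e‖ := by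
      rw [show θ + α • e - θstar = (θ - θstar) + α • e by abel]
      refine (norm_add_le _ _).trans ?_
      rw [norm_smul, Real.norm_eq_abs, abs_of_pos hα0]
    have h2 : ‖θ + α • e - θstar‖ ^ 2 ≤ (‖θ - θstar‖ + α * ‖e‖) ^ 2 := by gcongr
    nlinarith [sq_nonneg (‖θ - θstar‖ - α * ‖e‖)]
  rw [inner_sub_right]
  -- The drift acts at `θ` but the contraction is wanted at the perturbed point; the factor 2 in the
  -- drift pays for the change. The 8 here and the 9 of `b8` make 17.
  have b6 : α * m * ‖θ + α • e - θstar‖ ^ 2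
      ≤ 2 * α * (m * ‖θ - θstar‖ ^ 2) + 8 * (α ^ 2 * (δ * C) ^ 2) := by
    have h1 : α * m * ‖θ + α • e - θstar‖ ^ 2
        ≤ α * m * (2 * ‖θ - θstar‖ ^ 2 + 2 * (α ^ 2 * ‖e‖ ^ 2)) := by gcongr
    have h2 : α * m * (2 * (α ^ 2 * ‖e‖ ^ 2)) ≤ 1 * 1 * (2 * (α ^ 2 * (4 * (δ * C) ^ 2))) := by
      gcongr
    linarith
  have b7 : 2 * α * inner ℝ (θ - θstar) (M.meanDir π θ) ≤ -(2 * α * (m * ‖θ - θstar‖ ^ 2)) := by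
    have := mul_le_mul_of_nonneg_left hdrift (by positivity : 0 ≤ 2 * α)
    rw [hm]
    linarith
  have b8 : 2 * α ^ 2 * inner ℝ e g + α ^ 2 * ‖g‖ ^ 2 + α ^ 2 * ‖e'‖ ^ 2
      ≤ 9 * (α ^ 2 * (δ * C) ^ 2) := by
    have h1 := mul_le_mul_of_nonneg_left b1 (sq_nonneg α)
    have h2 := mul_le_mul_of_nonneg_left b2 (sq_nonneg α)
    have h3 := mul_le_mul_of_nonneg_left b3 (sq_nonneg α)
    linarith
  rw [show α * ωmin * (1 - M.γ) = α * m by rw [hm]; ring,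
    show α ^ 2 * δ ^ 2 * C ^ 2 = α ^ 2 * (δ * C) ^ 2 by ring]
  linarith

/-- The noise of the temporal difference changes little when the parameter does. -/
theorem noise_sub_le (h : M.EFTDSetting rbar π θstar B G δ Q α θ₀) (s s' : S)
    {θ θ' : EuclideanSpace ℝ (Fin K)} (hθ : θ ∈ B) (hθ' : θ' ∈ B) :
    inner ℝ (θ - θstar) (M.tdDir s s' θ - M.meanDir π θ)
      ≤ inner ℝ (θ' - θstar) (M.tdDir s s' θ' - M.meanDir π θ')
        + 6 * ((rbar + 2) * G) * ‖θ - θ'‖ := by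
  have h1 : inner ℝ (θ - θstar) (M.tdDir s s' θ - M.meanDir π θ)
      = inner ℝ (θ' - θstar) (M.tdDir s s' θ' - M.meanDir π θ')
        + inner ℝ (θ - θ') (M.tdDir s s' θ - M.meanDir π θ)
        + inner ℝ (θ' - θstar) ((M.tdDir s s' θ - M.tdDir s s' θ')
          - (M.meanDir π θ - M.meanDir π θ')) := by
    simp only [inner_sub_left, inner_sub_right]
    ring
  have h2 : inner ℝ (θ - θ') (M.tdDir s s' θ - M.meanDir π θ)
      ≤ ‖θ - θ'‖ * (2 * ((rbar + 2) * G)) := by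
    refine (real_inner_le_norm _ _).trans ?_
    gcongr
    linarith [norm_sub_le (M.tdDir s s' θ) (M.meanDir π θ), h.norm_tdDir_le s s' hθ,
      h.norm_meanDir_le hθ]
  have h3 : inner ℝ (θ' - θstar) ((M.tdDir s s' θ - M.tdDir s s' θ')
      - (M.meanDir π θ - M.meanDir π θ')) ≤ (2 * G) * (4 * ‖θ - θ'‖) := by
    refine (real_inner_le_norm _ _).trans ?_
    have h5 := h.one_le_G
    gcongr
    · exact h.norm_sub_fixedPoint_le hθ'
    · linarith [norm_sub_le (M.tdDir s s' θ - M.tdDir s s' θ')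
        (M.meanDir π θ - M.meanDir π θ'), h.standing.norm_tdDir_sub_le s s' θ θ',
        h.standing.norm_meanDir_sub_le h.stationary θ θ']
  -- The two error terms total `(2 rbar + 12) G ‖θ - θ'‖`; the stated bound exceeds this by four
  -- times the present quantity.
  have h4 : 0 ≤ rbar * G * ‖θ - θ'‖ := by
    have h5 := h.one_le_G
    have h6 := h.rbar_nonneg
    positivity
  linarith

/-- Valid at every time, it supplies the initial value of the recursion at time `τ`. -/
theorem norm_sq_perturbed_le (h : M.EFTDSetting rbar π θstar B G δ Q α θ₀) (x : ℕ → S) (t : ℕ) :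
    ‖(M.efTD Q B α θ₀ x t).1 + α • (M.efTD Q B α θ₀ x t).2 - θstar‖ ^ 2
      ≤ 8 * (rbar + 2) ^ 2 * (α ^ 2 * δ ^ 2 * G ^ 2 + G ^ 2) := by
  have h1 := h.norm_sub_fixedPoint_le (h.iterate_mem x t)
  have h2 := h.norm_memory_le x t
  generalize (M.efTD Q B α θ₀ x t).1 = θ at *
  generalize (M.efTD Q B α θ₀ x t).2 = e at *
  have hα0 := h.α_pos
  have hG := h.one_le_G
  have hr := h.rbar_nonneg
  have h3 : ‖θ + α • e - θstar‖ ≤ (rbar + 2) * (2 * G) + (rbar + 2) * (2 * (α * δ * G)) := by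
    rw [show θ + α • e - θstar = (θ - θstar) + α • e by abel]
    refine (norm_add_le _ _).trans (add_le_add (by nlinarith) ?_)
    rw [norm_smul, Real.norm_eq_abs, abs_of_pos hα0]
    nlinarith
  have h4 : ‖θ + α • e - θstar‖ ^ 2
      ≤ ((rbar + 2) * (2 * G) + (rbar + 2) * (2 * (α * δ * G))) ^ 2 := by gcongr
  nlinarith [sq_nonneg ((rbar + 2) * (2 * G) - (rbar + 2) * (2 * (α * δ * G)))]

theorem norm_sq_iterate_le (h : M.EFTDSetting rbar π θstar B G δ Q α θ₀) (x : ℕ → S) (t : ℕ) :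
    ‖(M.efTD Q B α θ₀ x t).1 - θstar‖ ^ 2
      ≤ 2 * ‖(M.efTD Q B α θ₀ x t).1 + α • (M.efTD Q B α θ₀ x t).2 - θstar‖ ^ 2
        + 8 * (α ^ 2 * δ ^ 2 * ((rbar + 2) * G) ^ 2) := by
  have h2 := h.norm_memory_le x t
  generalize (M.efTD Q B α θ₀ x t).1 = θ at *
  generalize (M.efTD Q B α θ₀ x t).2 = e at *
  have hα0 := h.α_pos
  set v := θ + α • e - θstar with hv
  have h3 : ‖θ - θstar‖ ≤ ‖v‖ + α * (2 * δ * ((rbar + 2) * G)) := by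
    rw [show θ - θstar = v - α • e by rw [hv]; abel]
    refine (norm_sub_le _ _).trans (add_le_add le_rfl ?_)
    rw [norm_smul, Real.norm_eq_abs, abs_of_pos hα0]
    gcongr
  have h4 : ‖θ - θstar‖ ^ 2 ≤ (‖v‖ + α * (2 * δ * ((rbar + 2) * G))) ^ 2 := by gcongr
  nlinarith [sq_nonneg (‖v‖ - α * (2 * δ * ((rbar + 2) * G)))]

end EFTDSetting

end PolicyEval

/-! ### The recursion in mean square -/

namespace PolicyEval

variable {S : Type*} [Fintype S] [MeasurableSpace S] [MeasurableSingletonClass S]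
  {K : ℕ} {M : PolicyEval S K} {rbar : ℝ} {π : S → ℝ} {θstar θ₀ : EuclideanSpace ℝ (Fin K)}
  {B : Set (EuclideanSpace ℝ (Fin K))} {G δ α ωmin : ℝ}
  {Q : EuclideanSpace ℝ (Fin K) → EuclideanSpace ℝ (Fin K)}
  {Ω : Type*} [MeasurableSpace Ω] {μ : Measure Ω} [IsProbabilityMeasure μ] {s : ℕ → Ω → S}

/-- The state at time `t` takes finitely many values, so arbitrary `Q` and `F` are harmless. -/
theorem integrable_efTD (hs : IsMarkovChain μ M.P s) (t : ℕ)
    (F : EuclideanSpace ℝ (Fin K) × EuclideanSpace ℝ (Fin K) → ℝ) :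
    Integrable (fun ω => F (M.efTD Q B α θ₀ (fun i => s i ω) t)) μ :=
  hs.integrable_of_dependsOn (t := t) (F := fun x => F (M.efTD Q B α θ₀ x t)) fun _ _ h =>
    congrArg F (dependsOn_efTD M Q B α θ₀ t h)

theorem integrable_noise (hs : IsMarkovChain μ M.P s) {t n : ℕ} (htn : t ≤ n) :
    Integrable (fun ω => inner ℝ ((M.efTD Q B α θ₀ (fun i => s i ω) t).1 - θstar)
      (M.tdDir (s n ω) (s (n + 1) ω) (M.efTD Q B α θ₀ (fun i => s i ω) t).1
        - M.meanDir π (M.efTD Q B α θ₀ (fun i => s i ω) t).1)) μ :=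
  hs.integrable_of_dependsOn (t := n + 1)
    (F := fun x => inner ℝ ((M.efTD Q B α θ₀ x t).1 - θstar)
      (M.tdDir (x n) (x (n + 1)) (M.efTD Q B α θ₀ x t).1
        - M.meanDir π (M.efTD Q B α θ₀ x t).1)) fun x x' h => by
    have h1 := dependsOn_efTD M Q B α θ₀ t
      fun i hi => h i (Set.mem_Iic.2 ((Set.mem_Iic.1 hi).trans (by omega)))
    beta_reduce at h1 ⊢
    rw [h1, h n (Set.mem_Iic.2 (by omega)), h (n + 1) (Set.mem_Iic.2 le_rfl)]

variable [DecidableEq S]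

namespace EFTDSetting

/-- The noise at a parameter that is `τ` steps old is small on average. -/
theorem integral_noise_le (h : M.EFTDSetting rbar π θstar B G δ Q α θ₀)
    (hs : IsMarkovChain μ M.P s) {τ : ℕ} (hτ : M.IsMixingTime π α τ) (t : ℕ) :
    ∫ ω, inner ℝ ((M.efTD Q B α θ₀ (fun i => s i ω) t).1 - θstar)
      (M.tdDir (s (t + τ) ω) (s (t + τ + 1) ω) (M.efTD Q B α θ₀ (fun i => s i ω) t).1
        - M.meanDir π (M.efTD Q B α θ₀ (fun i => s i ω) t).1) ∂μ ≤ 4 * α * G ^ 2 := by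
  have hdep : DependsOn (fun (x : ℕ → S) y z => (inner ℝ ((M.efTD Q B α θ₀ x t).1 - θstar)
      (M.tdDir y z (M.efTD Q B α θ₀ x t).1 - M.meanDir π (M.efTD Q B α θ₀ x t).1) : ℝ))
      (Set.Iic t) := fun x x' hx => by
    have h1 := dependsOn_efTD M Q B α θ₀ t hx
    beta_reduce at h1 ⊢
    rw [h1]
  rw [hs.integral_add_transition τ hdep]
  have hbound : ∀ ω, ∑ y, (M.P ^ τ) (s t ω) y * ∑ z, M.P y z *
      inner ℝ ((M.efTD Q B α θ₀ (fun i => s i ω) t).1 - θstar)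
        (M.tdDir y z (M.efTD Q B α θ₀ (fun i => s i ω) t).1
          - M.meanDir π (M.efTD Q B α θ₀ (fun i => s i ω) t).1) ≤ 4 * α * G ^ 2 := by
    intro ω
    have hθ := h.iterate_mem (fun i => s i ω) t
    generalize (M.efTD Q B α θ₀ (fun i => s i ω) t).1 = θ at hθ ⊢
    have h1 : ∀ y, ∑ z, M.P y z = 1 := fun y => (h.standing.row_mem_stdSimplex y).2
    have h2 : ∑ y, (M.P ^ τ) (s t ω) y = 1 :=
      Matrix.sum_row_of_mem_rowStochastic (pow_mem h.standing.stochastic τ) _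
    -- With `θ` frozen at time `t`, the average over the transition `τ` steps later is exactly
    -- `condDir`.
    have h3 : ∑ y, (M.P ^ τ) (s t ω) y * ∑ z, M.P y z *
        inner ℝ (θ - θstar) (M.tdDir y z θ - M.meanDir π θ)
        = inner ℝ (θ - θstar) (M.condDir τ (s t ω) θ - M.meanDir π θ) := by
      simp only [condDir, inner_sub_right, inner_sum, inner_smul_right, mul_sub,
        Finset.sum_sub_distrib, ← Finset.sum_mul, h1, h2, one_mul]
    rw [h3]
    refine (real_inner_le_norm _ _).trans ?_
    have h4 := hτ.1.2 τ le_rfl θ (s t ω)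
    have h5 := h.norm_sub_fixedPoint_le hθ
    have h6 := h.one_le_G
    have h7 := h.α_pos
    calc ‖θ - θstar‖ * ‖M.condDir τ (s t ω) θ - M.meanDir π θ‖
        ≤ (2 * G) * (α * (G + G)) := by
          gcongr
          exact h4.trans (by gcongr; exact h.norm_le hθ)
      _ = 4 * α * G ^ 2 := by ring
  calc _ ≤ ∫ _ω : Ω, 4 * α * G ^ 2 ∂μ := by
        refine integral_mono (hs.integrable_of_dependsOn (t := t) (F := fun x =>
          ∑ y, (M.P ^ τ) (x t) y * ∑ z, M.P y z *
            inner ℝ ((M.efTD Q B α θ₀ x t).1 - θstar)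
              (M.tdDir y z (M.efTD Q B α θ₀ x t).1
                - M.meanDir π (M.efTD Q B α θ₀ x t).1)) fun x x' hx => ?_)
          (integrable_const _) hbound
        have h1 := dependsOn_efTD M Q B α θ₀ t hx
        beta_reduce at h1 ⊢
        rw [h1, hx t (Set.mem_Iic.2 le_rfl)]
    _ = 4 * α * G ^ 2 := by simp

/-- One step of the algorithm in mean square, once the chain has mixed. -/
theorem integral_norm_sq_succ_le (h : M.EFTDSetting rbar π θstar B G δ Q α θ₀)
    (hω : M.IsSmallestEigenvalue π ωmin) (hstar : M.SolvesProjectedBellman π θstar)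
    (hα : α ≤ 1) (hs : IsMarkovChain μ M.P s) {τ : ℕ} (hτ : M.IsMixingTime π α τ) (t : ℕ) :
    ∫ ω, ‖(M.efTD Q B α θ₀ (fun i => s i ω) (t + τ + 1)).1
        + α • (M.efTD Q B α θ₀ (fun i => s i ω) (t + τ + 1)).2 - θstar‖ ^ 2 ∂μ
      ≤ (1 - α * ωmin * (1 - M.γ))
          * ∫ ω, ‖(M.efTD Q B α θ₀ (fun i => s i ω) (t + τ)).1
            + α • (M.efTD Q B α θ₀ (fun i => s i ω) (t + τ)).2 - θstar‖ ^ 2 ∂μ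
        + 115 * (α ^ 2 * τ * δ ^ 2 * ((rbar + 2) * G) ^ 2) := by
  set C := (rbar + 2) * G with hC
  have hα0 := h.α_pos
  have hG := h.one_le_G
  have hr := h.rbar_nonneg
  have hδ := h.one_le_δ
  have hGC : 2 * G ≤ C := by nlinarith
  have hC0 : 0 ≤ C := by linarith
  have hτ1 : (1 : ℝ) ≤ τ := by exact_mod_cast hτ.1.1
  set V : ℕ → Ω → ℝ := fun n ω => ‖(M.efTD Q B α θ₀ (fun i => s i ω) n).1
    + α • (M.efTD Q B α θ₀ (fun i => s i ω) n).2 - θstar‖ ^ 2 with hV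
  set N : Ω → ℝ := fun ω => inner ℝ ((M.efTD Q B α θ₀ (fun i => s i ω) t).1 - θstar)
      (M.tdDir (s (t + τ) ω) (s (t + τ + 1) ω) (M.efTD Q B α θ₀ (fun i => s i ω) t).1
        - M.meanDir π (M.efTD Q B α θ₀ (fun i => s i ω) t).1) with hN
  have hVint : ∀ n, Integrable (V n) μ := fun n =>
    integrable_efTD hs n fun p => ‖p.1 + α • p.2 - θstar‖ ^ 2
  have hNint : Integrable N μ := integrable_noise hs (Nat.le_add_right t τ)
  have hNle : ∫ ω, N ω ∂μ ≤ 4 * α * G ^ 2 := h.integral_noise_le hs hτ t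
  -- Here `96 = 2 · 6 · 8`: the factor `2α` of the noise, its Lipschitz constant `6C`, and the step
  -- bound `8αδC` over `τ` steps.
  set D := 96 * (α ^ 2 * δ * C ^ 2 * τ) + 17 * (α ^ 2 * δ ^ 2 * C ^ 2) with hD
  have hpath : ∀ ω, V (t + τ + 1) ω
      ≤ (1 - α * ωmin * (1 - M.γ)) * V (t + τ) ω + 2 * α * N ω + D := by
    intro ω
    have h1 := h.norm_sq_succ_le hω hstar hα (fun i => s i ω) (t + τ)
    have h2 := h.noise_sub_le (s (t + τ) ω) (s (t + τ + 1) ω)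
      (h.iterate_mem (fun i => s i ω) (t + τ)) (h.iterate_mem (fun i => s i ω) t)
    have h3 := h.norm_iterate_add_sub_le (fun i => s i ω) t τ
    have h4 := mul_le_mul_of_nonneg_left (h2.trans (add_le_add_right
      (mul_le_mul_of_nonneg_left h3 (by positivity)) _)) (by positivity : 0 ≤ 2 * α)
    refine h1.trans ?_
    simp only [hV, hN, hD]
    linarith
  have hint : ∫ ω, V (t + τ + 1) ω ∂μ
      ≤ (1 - α * ωmin * (1 - M.γ)) * ∫ ω, V (t + τ) ω ∂μ + 2 * α * ∫ ω, N ω ∂μ + D := by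
    have h1 := ((hVint (t + τ)).const_mul (1 - α * ωmin * (1 - M.γ)))
    have h2 := hNint.const_mul (2 * α)
    refine (integral_mono (hVint _) ((h1.add h2).add (integrable_const D)) hpath).trans
      (le_of_eq ?_)
    rw [integral_add' (h1.add h2) (integrable_const D), integral_add' h1 h2,
      integral_const_mul, integral_const_mul]
    simp
  have e1 : 2 * α * ∫ ω, N ω ∂μ ≤ 2 * (α ^ 2 * τ * δ ^ 2 * C ^ 2) := by
    calc 2 * α * ∫ ω, N ω ∂μ ≤ 2 * α * (4 * α * G ^ 2) := by gcongr
      _ = 2 * (α ^ 2 * 1 * 1 ^ 2 * (2 * G) ^ 2) := by ring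
      _ ≤ 2 * (α ^ 2 * τ * δ ^ 2 * C ^ 2) := by gcongr
  have e2 : D ≤ 113 * (α ^ 2 * τ * δ ^ 2 * C ^ 2) := by
    have h1 : α ^ 2 * δ * C ^ 2 * τ ≤ α ^ 2 * δ ^ 2 * C ^ 2 * τ := by
      gcongr
      exact le_self_pow₀ hδ two_ne_zero
    have h2 : α ^ 2 * 1 * δ ^ 2 * C ^ 2 ≤ α ^ 2 * τ * δ ^ 2 * C ^ 2 := by gcongr
    linarith
  linarith

end EFTDSetting

end PolicyEval

/-! ### Solving the recursion -/

theorem le_geometric_of_succ_le {u : ℕ → ℝ} {m D : ℝ} (hm : 0 < m) (hm1 : m ≤ 1)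
    (hu : ∀ n, u (n + 1) ≤ (1 - m) * u n + D) (hD : 0 ≤ D) (n : ℕ) :
    u n ≤ (1 - m) ^ n * u 0 + D / m := by
  induction n with
  | zero => simpa using div_nonneg hD hm.le
  | succ n ih =>
    calc u (n + 1) ≤ (1 - m) * ((1 - m) ^ n * u 0 + D / m) + D :=
          (hu n).trans (by gcongr)
      _ = (1 - m) ^ (n + 1) * u 0 + D / m := by
        field_simp
        ring

theorem theorem3 :
    ∃ c : ℝ, 1 ≤ c ∧ ∀ rbar : ℝ, 0 < rbar → ∃ κ₁ κ₂ : ℝ, 0 < κ₁ ∧ 0 < κ₂ ∧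
      ∀ (S : Type*) [Fintype S] [DecidableEq S] [MeasurableSpace S] [MeasurableSingletonClass S]
        (K : ℕ) (M : PolicyEval S K) (π : S → ℝ) (ωmin : ℝ)
        (θstar : EuclideanSpace ℝ (Fin K)) (B : Set (EuclideanSpace ℝ (Fin K))) (G : ℝ)
        (δ : ℝ) (Q : EuclideanSpace ℝ (Fin K) → EuclideanSpace ℝ (Fin K))
        (α : ℝ) (θ₀ : EuclideanSpace ℝ (Fin K))
        (Ω : Type*) [MeasurableSpace Ω] (μ : Measure Ω) [IsProbabilityMeasure μ]
        (s : ℕ → Ω → S),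
        M.Standing rbar →
        M.IsStationary π →
        M.IsSmallestEigenvalue π ωmin →
        M.SolvesProjectedBellman π θstar →
        Convex ℝ B → IsCompact B → 1 ≤ G → B ⊆ Metric.closedBall 0 G →
        θstar ∈ B → θ₀ ∈ B →
        1 ≤ δ → IsCompressor δ Q →
        0 < α → α ≤ (1 - M.γ) / c →
        IsMarkovChain μ M.P s →
        ∃ τ : ℕ, M.IsMixingTime π α τ ∧ ∀ T : ℕ, τ ≤ T →
          ∫ ω, ‖(M.efTD Q B α θ₀ (fun t => s t ω) T).1 - θstar‖ ^ 2 ∂μ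
            ≤ κ₁ * (α ^ 2 * δ ^ 2 * G ^ 2 + G ^ 2) * (1 - α * ωmin * (1 - M.γ)) ^ (T - τ)
              + κ₂ * (α * τ * δ ^ 2 * G ^ 2 / (ωmin * (1 - M.γ))) := by
  -- The step-size condition serves only to give `α ≤ 1`, so `c = 1` suffices. Returning from the
  -- perturbed iterate doubles 8 and 115 and adds 8: `16 = 2 · 8`, `238 = 2 · 115 + 8`.
  refine ⟨1, le_rfl, fun rbar hr => ⟨16 * (rbar + 2) ^ 2, 238 * (rbar + 2) ^ 2, by positivity,
    by positivity, ?_⟩⟩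
  intro S _ _ _ _ K M π ωmin θstar B G δ Q α θ₀ Ω _ μ _ s hM hπ hω hstar hconv hcomp hG hBG
    hstarB hθ₀ hδ hQ hα0 hα hs
  have h : M.EFTDSetting rbar π θstar B G δ Q α θ₀ :=
    ⟨hM, hr.le, hπ, hconv, hcomp, hG, hBG, hstarB, hθ₀, hδ, hQ, hα0⟩
  obtain ⟨τ, hτ⟩ := hM.exists_isMixingTime hπ hr.le hα0
  refine ⟨τ, hτ, fun T hT => ?_⟩
  obtain ⟨n, rfl⟩ := Nat.exists_eq_add_of_le' hT
  rw [Nat.add_sub_cancel]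
  have hγ0 := hM.γ_pos
  have hγ1 := hM.γ_lt_one
  have hα1 : α ≤ 1 := by rw [div_one] at hα; linarith
  have hω0 := hM.smallestEigenvalue_pos hπ hω
  have hω1 := hM.smallestEigenvalue_le_one hπ hω
  have hτ1 : (1 : ℝ) ≤ τ := by exact_mod_cast hτ.1.1
  set m := ωmin * (1 - M.γ) with hm
  have hm0 : 0 < m := mul_pos hω0 (by linarith)
  have hm1 : m ≤ 1 := by nlinarith
  have hαm : α * ωmin * (1 - M.γ) = α * m := by rw [hm]; ring
  rw [hαm]
  set u : ℕ → ℝ := fun n => ∫ ω, ‖(M.efTD Q B α θ₀ (fun i => s i ω) (n + τ)).1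
    + α • (M.efTD Q B α θ₀ (fun i => s i ω) (n + τ)).2 - θstar‖ ^ 2 ∂μ with hu
  have hstep : ∀ n, u (n + 1) ≤ (1 - α * m) * u n
      + 115 * (α ^ 2 * τ * δ ^ 2 * ((rbar + 2) * G) ^ 2) := by
    intro n
    have h1 := h.integral_norm_sq_succ_le hω hstar hα1 hs hτ n
    rw [hαm] at h1
    simpa only [hu, Nat.add_right_comm n 1 τ] using h1
  have hVint : ∀ n, Integrable (fun ω => ‖(M.efTD Q B α θ₀ (fun i => s i ω) n).1
      + α • (M.efTD Q B α θ₀ (fun i => s i ω) n).2 - θstar‖ ^ 2) μ := fun n =>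
    PolicyEval.integrable_efTD hs n fun p => ‖p.1 + α • p.2 - θstar‖ ^ 2
  have hαm1 : α * m ≤ 1 := by nlinarith
  have hgeo := le_geometric_of_succ_le (mul_pos hα0 hm0) hαm1 hstep (by positivity) n
  have hu0 : u 0 ≤ 8 * (rbar + 2) ^ 2 * (α ^ 2 * δ ^ 2 * G ^ 2 + G ^ 2) := by
    refine (integral_mono (hVint _) (integrable_const _)
      fun ω => h.norm_sq_perturbed_le (fun i => s i ω) (0 + τ)).trans (le_of_eq ?_)
    simp
  have hfin : ∫ ω, ‖(M.efTD Q B α θ₀ (fun t => s t ω) (n + τ)).1 - θstar‖ ^ 2 ∂μ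
      ≤ 2 * u n + 8 * (α ^ 2 * δ ^ 2 * ((rbar + 2) * G) ^ 2) := by
    refine (integral_mono (PolicyEval.integrable_efTD hs (n + τ)
      fun p => ‖p.1 - θstar‖ ^ 2) (((hVint (n + τ)).const_mul 2).add (integrable_const _))
      fun ω => h.norm_sq_iterate_le (fun i => s i ω) (n + τ)).trans (le_of_eq ?_)
    rw [integral_add' ((hVint (n + τ)).const_mul 2) (integrable_const _), integral_const_mul]
    simp [hu]
  have hpow : 0 ≤ (1 - α * m) ^ n := pow_nonneg (by linarith) n
  have e1 := mul_le_mul_of_nonneg_left hu0 hpow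
  have e2 : 115 * (α ^ 2 * τ * δ ^ 2 * ((rbar + 2) * G) ^ 2) / (α * m)
      = 115 * (rbar + 2) ^ 2 * (α * τ * δ ^ 2 * G ^ 2 / m) := by
    field_simp
  -- The cost of returning to `θ` is absorbed in the stationary error because `α ≤ 1 ≤ τ / m`.
  have e3 : α ^ 2 * δ ^ 2 * ((rbar + 2) * G) ^ 2
      ≤ (rbar + 2) ^ 2 * (α * τ * δ ^ 2 * G ^ 2 / m) := by
    have h1 : α * (1 * 1) * (δ ^ 2 * G ^ 2) ≤ α * (τ * (1 / m)) * (δ ^ 2 * G ^ 2) := by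
      gcongr
      rwa [one_le_div hm0]
    have h2 : α * α * (δ ^ 2 * G ^ 2) ≤ α * (1 * 1) * (δ ^ 2 * G ^ 2) := by
      gcongr
      linarith
    calc α ^ 2 * δ ^ 2 * ((rbar + 2) * G) ^ 2
        = (rbar + 2) ^ 2 * (α * α * (δ ^ 2 * G ^ 2)) := by ring
      _ ≤ (rbar + 2) ^ 2 * (α * (τ * (1 / m)) * (δ ^ 2 * G ^ 2)) := by
        exact mul_le_mul_of_nonneg_left (h2.trans h1) (by positivity)
      _ = (rbar + 2) ^ 2 * (α * τ * δ ^ 2 * G ^ 2 / m) := by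
        field_simp
  rw [e2] at hgeo
  linarith
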